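/- Fix a positive integer $M$. A sequence is an element $c=(c_i)_{i\ge1}$ of $\{0,1,\ldots,M\}^{\mathbb N}$; the set of sequences carries the metric for which two different sequences have distance $2^{-n}$, where $n$ is the first index with $c_n\ne d_n$. For $q>1$, a sequence $c$ is an expansion of $x\in\mathbb R$ in base $q$ if $\sum_{i\ge1}c_iq^{-i}=x$. The reflection of $c$ is $\overline{c}=(M-c_i)_{i\ge1}$. A sequence is infinite if it has no last nonzero digit (so $0^\infty$ counts as infinite), and doubly infinite if both it and its reflection are infinite. The quasi-greedy expansion of $x$ in base $q$ is the lexicographically largest infinite expansion of $x$ in base $q$, if $x$ has one. Let $\alpha(q)$ be the quasi-greedy expansion of $1$ in base $q$ if $1<q\le M+1$, and $\alpha(q)=M^\infty$ if $q>M+1$. For $q>1$ let $\mathcal U_q$ be the set of real numbers having a unique expansion in base $q$, and $\mathcal U_q'$ the set of these expansions. Let $\mathcal V_q$ be the set of real numbers $x$ that have a quasi-greedy expansion $(a_i)$ in base $q$ such that $\overline{a_{n+1}a_{n+2}\cdots}\le\alpha(q)$ lexicographically whenever $n\ge1$ and $a_n>0$, and let $\mathcal V_q'$ be the set of the quasi-greedy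 expansions of the elements of $\mathcal V_q$. Let $\mathcal U$ be the set of bases $q>1$ in which $1$ has a unique expansion, and $\mathcal V$ the set of bases $q>1$ in which $1$ has a unique doubly infinite expansion. Distances of subsets of $\mathbb R$ and of the space of sequences are taken in the sense of Hausdorff. (i) The maps $q\mapsto\mathcal U_q'$ and $q\mapsto\mathcal U_q$ are left continuous on $(1,\infty)$. (ii) The maps $q\mapsto\mathcal V_q'$ and $q\mapsto\mathcal V_q$ are right continuous on $(1,\infty)$. (iii) Each of the four maps $q\mapsto\mathcal U_q'$, $q\mapsto\mathcal U_q$, $q\mapsto\mathcal V_q'$, $q\mapsto\mathcal V_q$ is continuous at $q\in(1,\infty)$ if and only if $q\notin\mathcal V\setminus\overline{\mathcal U}$, where $\overline{\mathcal U}$ is the closure of $\mathcal U$. -/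

import Mathlib

open Set Filter Topology

/-- Digit sequences `(c₁, c₂, …)` over the alphabet `{0, 1, …, M}`. The index is shifted:
`c i` is the `(i+1)`-st digit. -/
@[ext]
structure DigitSeq (M : ℕ) where
  /-- The digits. -/
  digit : ℕ → Fin (M + 1)

namespace DigitSeq

variable {M : ℕ}

instance : CoeFun (DigitSeq M) (fun _ => ℕ → Fin (M + 1)) := ⟨digit⟩

open Classical in
/-- The distance of two different sequences is `2⁻ⁿ`, where the `n`-th digits (counted from `1`)
are the first ones that differ. -/
noncomputable def seqDist (c d : DigitSeq M) : ℝ :=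
  if h : ∃ i, c i ≠ d i then (1 / 2 : ℝ) ^ (Nat.find h + 1) else 0

theorem seqDist_self (c : DigitSeq M) : seqDist c c = 0 := by
  simp [seqDist]

theorem seqDist_comm (c d : DigitSeq M) : seqDist c d = seqDist d c := by
  by_cases h : ∃ i, c i ≠ d i
  · have h' : ∃ i, d i ≠ c i := h.imp fun _ hi => hi.symm
    rw [seqDist, seqDist, dif_pos h, dif_pos h']
    congr 2
    exact Nat.find_congr' ne_comm
  · have h' : ¬ ∃ i, d i ≠ c i := fun ⟨i, hi⟩ => h ⟨i, hi.symm⟩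
    rw [seqDist, seqDist, dif_neg h, dif_neg h']

theorem seqDist_nonneg (c d : DigitSeq M) : 0 ≤ seqDist c d := by
  unfold seqDist
  split_ifs <;> positivity

open Classical in
theorem eq_of_seqDist_eq_zero {c d : DigitSeq M} (h : seqDist c d = 0) : c = d := by
  by_contra hne
  have hex : ∃ i, c i ≠ d i := by
    by_contra hcon
    push Not at hcon
    exact hne (DigitSeq.ext (funext hcon))
  rw [seqDist, dif_pos hex] at h
  have : (0 : ℝ) < (1 / 2 : ℝ) ^ (Nat.find hex + 1) := by positivity
  linarith

open Classical in
theorem seqDist_le_max (c d e : DigitSeq M) :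
    seqDist c e ≤ max (seqDist c d) (seqDist d e) := by
  by_cases hce : ∃ i, c i ≠ e i
  · have hspec := Nat.find_spec hce
    have key : ∀ a b : DigitSeq M, a (Nat.find hce) ≠ b (Nat.find hce) →
        (1 / 2 : ℝ) ^ (Nat.find hce + 1) ≤ seqDist a b := by
      intro a b hab
      have hex : ∃ i, a i ≠ b i := ⟨_, hab⟩
      rw [seqDist, dif_pos hex]
      exact pow_le_pow_of_le_one (by norm_num) (by norm_num)
        (Nat.succ_le_succ (Nat.find_min' hex hab))
    have hval : seqDist c e = (1 / 2 : ℝ) ^ (Nat.find hce + 1) := by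
      rw [seqDist, dif_pos hce]
    rw [hval]
    by_cases hcd : c (Nat.find hce) = d (Nat.find hce)
    · exact le_max_of_le_right (key d e (hcd ▸ hspec))
    · exact le_max_of_le_left (key c d hcd)
  · rw [seqDist, dif_neg hce]
    exact le_max_of_le_left (seqDist_nonneg c d)

noncomputable instance : MetricSpace (DigitSeq M) where
  dist := seqDist
  dist_self := seqDist_self
  dist_comm := seqDist_comm
  dist_triangle c d e := (seqDist_le_max c d e).trans
    (max_le_add_of_nonneg (seqDist_nonneg c d) (seqDist_nonneg d e))
  eq_of_dist_eq_zero := eq_of_seqDist_eq_zero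

/-- The lexicographic order `c ≤ d`. -/
def LexLE (c d : DigitSeq M) : Prop :=
  c = d ∨ ∃ n, (∀ i < n, c i = d i) ∧ c n < d n

/-- The reflection `(M - cᵢ)`. -/
def reflect (c : DigitSeq M) : DigitSeq M := ⟨fun i => (c i).rev⟩

/-- The sequence that remains after the first `n` digits are deleted. -/
def drop (n : ℕ) (c : DigitSeq M) : DigitSeq M := ⟨fun i => c (n + i)⟩

/-- A sequence is infinite if it has no last nonzero digit; the zero sequence counts as infinite. -/
def IsInfinite (c : DigitSeq M) : Prop := ∀ n, c n ≠ 0 → ∃ m, n < m ∧ c m ≠ 0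

/-- A sequence is doubly infinite if it and its reflection are infinite. -/
def IsDoublyInfinite (c : DigitSeq M) : Prop := c.IsInfinite ∧ c.reflect.IsInfinite

/-- `c` is an expansion of `x` in base `q`. -/
def IsExpansion (q x : ℝ) (c : DigitSeq M) : Prop :=
  HasSum (fun i : ℕ => ((c i : ℕ) : ℝ) / q ^ (i + 1)) x

/-- `c` is the quasi-greedy expansion of `x` in base `q`: the lexicographically largest infinite
expansion of `x`. -/
def IsQuasiGreedy (q x : ℝ) (c : DigitSeq M) : Prop :=
  c.IsExpansion q x ∧ c.IsInfinite ∧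
    ∀ d : DigitSeq M, d.IsExpansion q x → d.IsInfinite → d.LexLE c

end DigitSeq

/-- `𝒰_q`: the real numbers having a unique expansion in base `q`. -/
def univoqueNumbers (M : ℕ) (q : ℝ) : Set ℝ :=
  {x | ∃! c : DigitSeq M, c.IsExpansion q x}

/-- `𝒰_q'`: the expansions of the elements of `𝒰_q`. -/
def univoqueSeqs (M : ℕ) (q : ℝ) : Set (DigitSeq M) :=
  {c | ∃ x ∈ univoqueNumbers M q, c.IsExpansion q x}

/-- `𝒱_q`: the numbers `x` that have a quasi-greedy expansion `(aᵢ)` such that the reflection of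
`(aₙ₊₁, aₙ₊₂, …)` is lexicographically at most `α(q)` whenever `aₙ > 0`. Here `α(q)` is the
quasi-greedy expansion of `1` in base `q`. It exists (and is unique) if `1 < q ≤ M + 1`; for
`q > M + 1` the number `1` has no expansion and there is no restriction, which is the same as
the convention `α(q) = M^∞`. -/
def vNumbers (M : ℕ) (q : ℝ) : Set ℝ :=
  {x | ∃ a : DigitSeq M, a.IsQuasiGreedy q x ∧
    ∀ α : DigitSeq M, α.IsQuasiGreedy q 1 →
      ∀ n, 0 < a n → (a.drop (n + 1)).reflect.LexLE α}

/-- `𝒱_q'`: the quasi-greedy expansions of the elements of `𝒱_q`. -/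
def vSeqs (M : ℕ) (q : ℝ) : Set (DigitSeq M) :=
  {a | ∃ x ∈ vNumbers M q, a.IsQuasiGreedy q x}

/-- `𝒰`: the bases in which `1` has a unique expansion. -/
def univoqueBases (M : ℕ) : Set ℝ :=
  {q | 1 < q ∧ ∃! c : DigitSeq M, c.IsExpansion q 1}

/-- `𝒱`: the bases in which `1` has a unique doubly infinite expansion. -/
def vBases (M : ℕ) : Set ℝ :=
  {q | 1 < q ∧ ∃! c : DigitSeq M, c.IsExpansion q 1 ∧ c.IsDoublyInfinite}

/-- Continuity at `q`, relative to `s`, of a set-valued map for the Hausdorff distance. -/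
def HausdorffContinuousWithinAt {X : Type*} [MetricSpace X] (F : ℝ → Set X) (s : Set ℝ)
    (q : ℝ) : Prop :=
  Tendsto (fun p => Metric.hausdorffEDist (F p) (F q)) (𝓝[s] q) (𝓝 0)

/-- Left continuity at `q` of a set-valued map on `(1, ∞)`. -/
def HausdorffLeftContinuousAt {X : Type*} [MetricSpace X] (F : ℝ → Set X) (q : ℝ) : Prop :=
  HausdorffContinuousWithinAt F (Ioc 1 q) q

/-- Right continuity at `q` of a set-valued map on `(1, ∞)`. -/
def HausdorffRightContinuousAt {X : Type*} [MetricSpace X] (F : ℝ → Set X) (q : ℝ) : Prop :=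
  HausdorffContinuousWithinAt F (Ici q) q

/-- Continuity at `q` of a set-valued map on `(1, ∞)`. -/
def HausdorffContinuousAt {X : Type*} [MetricSpace X] (F : ℝ → Set X) (q : ℝ) : Prop :=
  HausdorffContinuousWithinAt F (Ioi 1) q

/-! Everything is governed by values of tails. `𝒰_q'` consists of the sequences in which every tail
following a digit less than `M` has value less than `1`, the same holding for the reflection
(`mem_univoqueSeqs_iff`); `𝒱_q'` consists of the infinite sequences with "at most `1`" instead
(`mem_vSeqs_iff`). Values decrease in the base, so both families grow with `q`, and `𝒱_p' ⊆ 𝒰_q'`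
for `p < q`. The weak condition is closed jointly in base and sequence, so compactness of the
sequence space gives upper semicontinuity (`eventually_twoSided_agree`) and, with monotonicity,
(ii).

Lower semicontinuity needs room. For `q ≤ M + 1` and `a = α(q)`, the bounds become lexicographic
comparisons with `a`. If all of them are decided within a fixed number of digits (`BlockBound`), the
tail values stay a fixed distance below `1`, and the sequence remains in `𝒰_p'` for all `p` near
`q`. Such sequences approximate all of `𝒰_q'`: if some reflected tail of `a` after a nonzero digit
is at least `a`, then every element of `𝒰_q'` is itself block bounded; otherwise `a` is strict, and
prefixes extend to block bounded sequences (`Admissible.exists_extension`). This gives (i). The same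
approximation works for the weak condition, hence all four maps are continuous, unless `a` satisfies
the weak condition without being strict (`IsJump`). For `q > M + 1` there is no restriction at all.

At a jump, `a` is the reflection of one of its own tails, which isolates it from `𝒰_q'`
(`not_agree_of_strictLexBound`). Since `a ∈ 𝒰_p'` for `p > q` and `𝒱_p' ⊆ 𝒰_q'` for `p < q`, all
four maps are discontinuous. Finally, jumps are exactly the elements of `𝒱` outside the closure of
`𝒰` (`isJump_iff`): a strict `a` makes `q` a limit of bases in `𝒰`, while at a jump the isolation
argument, applied to expansions of `1` in nearby bases, forbids this. -/

namespace DigitSeq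

variable {M : ℕ}

/-! ### Lexicographic order, tails and reflection -/

noncomputable instance : LinearOrder (DigitSeq M) :=
  LinearOrder.lift' (fun c => (toLex c.digit : Lex (ℕ → Fin (M + 1)))) fun _ _ h =>
    DigitSeq.ext (toLex.injective h)

theorem lt_iff {c d : DigitSeq M} : c < d ↔ ∃ n, (∀ i < n, c i = d i) ∧ c n < d n := Iff.rfl

theorem lexLE_iff {c d : DigitSeq M} : c.LexLE d ↔ c ≤ d := by
  rw [LexLE, ← lt_iff, le_iff_eq_or_lt]

theorem digit_ext {c d : DigitSeq M} (h : ∀ i, c i = d i) : c = d := DigitSeq.ext (funext h)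

@[simp] theorem drop_apply (n i : ℕ) (c : DigitSeq M) : c.drop n i = c (n + i) := rfl

@[simp] theorem reflect_apply (i : ℕ) (c : DigitSeq M) : c.reflect i = (c i).rev := rfl

@[simp] theorem drop_zero (c : DigitSeq M) : c.drop 0 = c := digit_ext fun i => by simp

theorem drop_drop (m n : ℕ) (c : DigitSeq M) : (c.drop n).drop m = c.drop (n + m) :=
  digit_ext fun i => by simp [add_assoc]

@[simp] theorem reflect_reflect (c : DigitSeq M) : c.reflect.reflect = c :=
  digit_ext fun i => by simp

theorem reflect_drop (n : ℕ) (c : DigitSeq M) : (c.drop n).reflect = c.reflect.drop n := rfl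

theorem rev_ne_last {x : Fin (M + 1)} : x.rev ≠ Fin.last M ↔ x ≠ 0 := by
  rw [Ne, Fin.rev_eq_iff, Fin.rev_last]

theorem rev_ne_zero {x : Fin (M + 1)} : x.rev ≠ 0 ↔ x ≠ Fin.last M := by
  rw [Ne, Fin.rev_eq_iff, Fin.rev_zero]

theorem reflect_lt_reflect {c d : DigitSeq M} (h : c < d) : d.reflect < c.reflect := by
  obtain ⟨n, h1, h2⟩ := lt_iff.1 h
  exact lt_iff.2 ⟨n, fun i hi => by simp [h1 i hi], by simpa using h2⟩

/-- The largest sequence `M^∞`. -/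
def top (M : ℕ) : DigitSeq M := ⟨fun _ => Fin.last M⟩

@[simp] theorem top_apply (i : ℕ) : top M i = Fin.last M := rfl

theorem le_topSeq (c : DigitSeq M) : c ≤ top M := by
  by_contra h
  obtain ⟨n, -, h2⟩ := lt_iff.1 (not_le.1 h)
  exact absurd h2 (not_lt.2 (Fin.le_last _))

theorem drop_lt_drop {c d : DigitSeq M} {m : ℕ} (h : ∀ i < m, c i = d i) (hcd : c < d) :
    c.drop m < d.drop m := by
  obtain ⟨n, h1, h2⟩ := lt_iff.1 hcd
  have hmn : m ≤ n := by
    by_contra hlt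
    exact h2.ne (h n (not_le.1 hlt))
  exact lt_iff.2 ⟨n - m, fun i hi => h1 _ (by omega), by
    simpa [Nat.add_sub_cancel' hmn] using h2⟩

/-! ### Metric and topology -/

theorem dist_def (c d : DigitSeq M) : dist c d = seqDist c d := rfl

theorem agree_of_dist_lt {c d : DigitSeq M} {n : ℕ} (h : dist c d < (1 / 2 : ℝ) ^ n) :
    ∀ i < n, c i = d i := by
  classical
  intro i hi
  by_contra hne
  have hex : ∃ i, c i ≠ d i := ⟨i, hne⟩
  rw [dist_def, seqDist, dif_pos hex] at h
  have h3 : Nat.find hex ≤ i := Nat.find_min' hex hne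
  have : (1 / 2 : ℝ) ^ n ≤ (1 / 2 : ℝ) ^ (Nat.find hex + 1) :=
    pow_le_pow_of_le_one (by norm_num) (by norm_num) (by omega)
  have h' : (1 / 2 : ℝ) ^ (Nat.find hex + 1) < (1 / 2 : ℝ) ^ n := by convert h
  linarith

theorem dist_lt_of_agree {c d : DigitSeq M} {n : ℕ} (h : ∀ i < n, c i = d i) :
    dist c d < (1 / 2 : ℝ) ^ n := by
  classical
  rw [dist_def, seqDist]
  split_ifs with hex
  · have h3 : n ≤ Nat.find hex := by
      by_contra hlt
      exact Nat.find_spec hex (h _ (not_le.1 hlt))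
    calc (1 / 2 : ℝ) ^ (Nat.find hex + 1) < (1 / 2 : ℝ) ^ (Nat.find hex) :=
          pow_lt_pow_right_of_lt_one₀ (by norm_num) (by norm_num) (Nat.lt_succ_self _)
      _ ≤ (1 / 2 : ℝ) ^ n := pow_le_pow_of_le_one (by norm_num) (by norm_num) h3
  · positivity

theorem exists_dist_lt_of_agree {ε : ℝ} (hε : 0 < ε) :
    ∃ n : ℕ, ∀ c d : DigitSeq M, (∀ i < n, c i = d i) → dist c d < ε := by
  obtain ⟨n, hn⟩ := exists_pow_lt_of_lt_one hε (by norm_num : (1 / 2 : ℝ) < 1)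
  exact ⟨n, fun c d h => (dist_lt_of_agree h).trans hn⟩

theorem eventually_agree (c : DigitSeq M) (n : ℕ) : ∀ᶠ d in 𝓝 c, ∀ i < n, d i = c i := by
  filter_upwards [Metric.ball_mem_nhds c (show (0 : ℝ) < (1 / 2) ^ n by positivity)] with d hd
  exact agree_of_dist_lt hd

theorem mem_closure_iff_agree {s : Set (DigitSeq M)} {c : DigitSeq M} :
    c ∈ closure s ↔ ∀ n, ∃ d ∈ s, ∀ i < n, d i = c i := by
  constructor
  · intro h n
    obtain ⟨d, hd, hds⟩ := mem_closure_iff_nhds.1 h _ (eventually_agree c n)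
    exact ⟨d, hds, hd⟩
  · intro h
    rw [Metric.mem_closure_iff]
    intro ε hε
    obtain ⟨n, hn⟩ := exists_dist_lt_of_agree (M := M) hε
    obtain ⟨d, hd, hdc⟩ := h n
    exact ⟨d, hd, hn _ _ fun i hi => (hdc i hi).symm⟩

/-- This half of the comparison with the product topology suffices to transport Tychonoff
compactness. -/
theorem continuous_mk : Continuous (fun f : ℕ → Fin (M + 1) => (⟨f⟩ : DigitSeq M)) := by
  rw [continuous_iff_continuousAt]
  intro f
  rw [ContinuousAt, Metric.tendsto_nhds]
  intro ε hε
  obtain ⟨n, hn⟩ := exists_dist_lt_of_agree (M := M) hε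
  have : ∀ᶠ g in 𝓝 f, ∀ i ∈ Finset.range n, g i = f i := by
    rw [Filter.eventually_all_finset]
    intro i _
    exact ((continuous_apply i).tendsto f).eventually
      (show {f i} ∈ 𝓝 (f i) from (isOpen_discrete _).mem_nhds rfl)
  filter_upwards [this] with g hg
  exact hn _ _ fun i hi => hg i (Finset.mem_range.2 hi)

instance : CompactSpace (DigitSeq M) := by
  refine ⟨?_⟩
  have h := isCompact_range (continuous_mk (M := M))
  rwa [show range (fun f : ℕ → Fin (M + 1) => (⟨f⟩ : DigitSeq M)) = univ from
    eq_univ_of_forall fun c => ⟨c.digit, rfl⟩] at h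

/-! ### The value of a sequence -/

/-- The value `∑ cᵢ q⁻ⁱ` of a sequence in base `q`. -/
noncomputable def val (q : ℝ) (c : DigitSeq M) : ℝ := ∑' i : ℕ, ((c i : ℕ) : ℝ) / q ^ (i + 1)

theorem digit_le (c : DigitSeq M) (i : ℕ) : ((c i : ℕ) : ℝ) ≤ M := by
  exact_mod_cast Fin.is_le (c i)

theorem hasSum_geometric_shift {q : ℝ} (hq : 1 < q) (x : ℝ) :
    HasSum (fun i : ℕ => x / q ^ (i + 1)) (x / (q - 1)) := by
  have h := (hasSum_geometric_of_lt_one (r := q⁻¹) (by positivity)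
    (inv_lt_one_of_one_lt₀ hq)).mul_left (x / q)
  have h1 : (fun i : ℕ => x / q ^ (i + 1)) = fun i => x / q * q⁻¹ ^ i := by
    funext i
    rw [pow_succ, inv_pow]
    have : q ≠ 0 := by linarith
    field_simp
  have h2 : x / (q - 1) = x / q * (1 - q⁻¹)⁻¹ := by
    have : q - 1 ≠ 0 := by linarith
    have : q ≠ 0 := by linarith
    have : 1 - q⁻¹ ≠ 0 := by
      rw [sub_ne_zero]
      exact (inv_lt_one_of_one_lt₀ hq).ne'
    field_simp
  rw [h1, h2]
  exact h

theorem summable_val {q : ℝ} (hq : 1 < q) (c : DigitSeq M) :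
    Summable (fun i : ℕ => ((c i : ℕ) : ℝ) / q ^ (i + 1)) := by
  refine Summable.of_nonneg_of_le (fun i => by positivity) (fun i => ?_)
    (hasSum_geometric_shift hq (M : ℝ)).summable
  have := digit_le c i
  gcongr

theorem isExpansion_iff {q : ℝ} (hq : 1 < q) {c : DigitSeq M} {x : ℝ} :
    c.IsExpansion q x ↔ val q c = x := (summable_val hq c).hasSum_iff

theorem val_nonneg {q : ℝ} (hq : 1 < q) (c : DigitSeq M) : 0 ≤ val q c :=
  tsum_nonneg fun i => by positivity

theorem val_reflect {q : ℝ} (hq : 1 < q) (c : DigitSeq M) :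
    val q c.reflect = M / (q - 1) - val q c := by
  have h := ((hasSum_geometric_shift hq (M : ℝ)).sub (summable_val hq c).hasSum).tsum_eq
  rw [val, val, ← h]
  refine tsum_congr fun i => ?_
  have : ((c.reflect i : ℕ) : ℝ) = M - (c i : ℕ) := by
    rw [reflect_apply, Fin.val_rev, Nat.cast_sub (by omega)]
    push_cast; ring
  rw [this]; ring

theorem val_le {q : ℝ} (hq : 1 < q) (c : DigitSeq M) : val q c ≤ M / (q - 1) := by
  have := val_nonneg hq c.reflect
  rw [val_reflect hq] at this
  linarith

theorem mul_val {q : ℝ} (hq : 1 < q) (c : DigitSeq M) :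
    q * val q c = (c 0 : ℕ) + val q (c.drop 1) := by
  have hq0 : q ≠ 0 := by linarith
  rw [val, (summable_val hq c).tsum_eq_zero_add, val, mul_add, ← tsum_mul_left]
  congr 1
  · rw [zero_add, pow_one]
    field_simp
  · refine tsum_congr fun i => ?_
    rw [drop_apply, add_comm 1 i, pow_succ q (i + 1)]
    field_simp

theorem mul_val_drop {q : ℝ} (hq : 1 < q) (c : DigitSeq M) (n : ℕ) :
    q * val q (c.drop n) = (c n : ℕ) + val q (c.drop (n + 1)) := by
  rw [mul_val hq, drop_drop]; rfl

theorem pow_mul_val_sub {q : ℝ} (hq : 1 < q) {c d : DigitSeq M} {n : ℕ}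
    (h : ∀ i < n, c i = d i) :
    q ^ n * (val q c - val q d) = val q (c.drop n) - val q (d.drop n) := by
  induction n with
  | zero => simp
  | succ n ih =>
    have h1 := ih fun i hi => h i (by omega)
    have h2 := mul_val_drop hq c n
    have h3 := mul_val_drop hq d n
    rw [h n (by omega)] at h2
    rw [pow_succ, mul_comm (q ^ n) q, mul_assoc, h1]
    linarith

theorem pow_succ_mul_val_sub {q : ℝ} (hq : 1 < q) {c d : DigitSeq M} {n : ℕ}
    (h : ∀ i < n, c i = d i) :
    q ^ (n + 1) * (val q c - val q d) =
      ((c n : ℕ) - (d n : ℕ)) + (val q (c.drop (n + 1)) - val q (d.drop (n + 1))) := by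
  have h1 := pow_mul_val_sub hq h
  have h2 := mul_val_drop hq c n
  have h3 := mul_val_drop hq d n
  rw [pow_succ, mul_comm (q ^ n) q, mul_assoc, h1]
  linarith

theorem val_eq_zero_iff {q : ℝ} (hq : 1 < q) {c : DigitSeq M} : val q c = 0 ↔ ∀ n, c n = 0 := by
  rw [val, ← (summable_val hq c).hasSum_iff, hasSum_zero_iff_of_nonneg (fun i => by
    have := digit_le c i
    positivity), funext_iff]
  have hq0 : q ≠ 0 := by linarith
  constructor
  · intro h n
    have := h n
    simp [hq0] at this
    exact this
  · intro h i
    simp [h i]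

theorem val_pos_iff {q : ℝ} (hq : 1 < q) {c : DigitSeq M} : 0 < val q c ↔ ∃ n, c n ≠ 0 := by
  rw [(val_nonneg hq c).lt_iff_ne', Ne, val_eq_zero_iff hq]
  push Not
  rfl

theorem eq_top_of_val {q : ℝ} (hq : 1 < q) {c : DigitSeq M} (h : val q c = M / (q - 1)) :
    c = top M := by
  have h0 : val q c.reflect = 0 := by rw [val_reflect hq, h, sub_self]
  rw [val_eq_zero_iff hq] at h0
  refine digit_ext fun i => ?_
  have := h0 i
  rw [reflect_apply, Fin.rev_eq_iff, Fin.rev_zero] at this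
  simpa using this

theorem val_anti {p q : ℝ} (hp : 1 < p) (hpq : p ≤ q) (c : DigitSeq M) : val q c ≤ val p c := by
  refine (summable_val (hp.trans_le hpq) c).tsum_le_tsum (fun i => ?_) (summable_val hp c)
  have : 0 < p := by linarith
  gcongr

theorem val_lt_val {p q : ℝ} (hp : 1 < p) (hpq : p < q) {c : DigitSeq M} (hc : ∃ n, c n ≠ 0) :
    val q c < val p c := by
  obtain ⟨n, hn⟩ := hc
  have hp0 : 0 < p := by linarith
  refine Summable.tsum_lt_tsum (i := n) (fun i => ?_) ?_ (summable_val (hp.trans hpq) c)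
    (summable_val hp c)
  · dsimp only
    gcongr
  · have : (0 : ℝ) < (c n : ℕ) := by
      exact_mod_cast Nat.pos_of_ne_zero fun h => hn (Fin.ext h)
    gcongr

/-- The changes in value of `c` and of its reflection have the same sign and add up to the change of
`M / (q - 1)`. The bound is therefore uniform in `c`. -/
theorem abs_val_sub_le {p q : ℝ} (hp : 1 < p) (hq : 1 < q) (c : DigitSeq M) :
    |val p c - val q c| ≤ |(M : ℝ) / (p - 1) - M / (q - 1)| := by
  wlog h : p ≤ q generalizing p q
  · rw [abs_sub_comm, abs_sub_comm ((M : ℝ) / (p - 1))]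
    exact this hq hp (le_of_not_ge h)
  have h1 := val_anti hp h c
  have h2 := val_anti hp h c.reflect
  rw [val_reflect hp, val_reflect hq] at h2
  rw [abs_of_nonneg (by linarith)]
  exact le_trans (by linarith) (le_abs_self _)

theorem eventually_abs_val_sub_lt {q : ℝ} (hq : 1 < q) {ε : ℝ} (hε : 0 < ε) :
    ∀ᶠ p in 𝓝 q, ∀ c : DigitSeq M, |val p c - val q c| < ε := by
  have hcont : ContinuousAt (fun p : ℝ => (M : ℝ) / (p - 1)) q :=
    continuousAt_const.div (continuousAt_id.sub continuousAt_const) (by simp; linarith)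
  filter_upwards [Metric.tendsto_nhds.1 hcont ε hε, lt_mem_nhds hq] with p h1 h2 c
  exact (abs_val_sub_le h2 hq c).trans_lt h1

theorem abs_val_sub_le_of_agree {q : ℝ} (hq : 1 < q) {c d : DigitSeq M} {n : ℕ}
    (h : ∀ i < n, c i = d i) : |val q c - val q d| ≤ M / (q - 1) / q ^ n := by
  have hqn : 0 < q ^ n := pow_pos (by linarith) n
  rw [le_div_iff₀ hqn, ← abs_of_pos hqn, ← abs_mul, mul_comm, pow_mul_val_sub hq h, abs_le]
  have := val_nonneg hq (c.drop n)
  have := val_nonneg hq (d.drop n)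
  have := val_le hq (c.drop n)
  have := val_le hq (d.drop n)
  constructor <;> linarith

theorem exists_agree_val_lt (M : ℕ) {q : ℝ} (hq : 1 < q) {ε : ℝ} (hε : 0 < ε) :
    ∃ n : ℕ, ∀ c d : DigitSeq M, (∀ i < n, c i = d i) → |val q c - val q d| < ε := by
  have hlim : Tendsto (fun n : ℕ => (M : ℝ) / (q - 1) / q ^ n) atTop (𝓝 0) :=
    tendsto_const_nhds.div_atTop (tendsto_pow_atTop_atTop_of_one_lt hq)
  obtain ⟨n, hn⟩ := ((tendsto_order.1 hlim).2 ε hε).exists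
  exact ⟨n, fun c d h => (abs_val_sub_le_of_agree hq h).trans_lt hn⟩

theorem tendsto_val {ι : Type*} {l : Filter ι} {p : ι → ℝ} {c : ι → DigitSeq M} {q : ℝ}
    {d : DigitSeq M} (hq : 1 < q) (hp : Tendsto p l (𝓝 q)) (hc : Tendsto c l (𝓝 d)) :
    Tendsto (fun i => val (p i) (c i)) l (𝓝 (val q d)) := by
  rw [Metric.tendsto_nhds]
  intro ε hε
  obtain ⟨n, hn⟩ := exists_agree_val_lt M hq (half_pos hε)
  filter_upwards [hp.eventually (eventually_abs_val_sub_lt (M := M) hq (half_pos hε)),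
    hc.eventually (eventually_agree d n)] with i h1 h2
  have h3 := abs_lt.1 (h1 (c i))
  have h4 := abs_lt.1 (hn _ _ h2)
  rw [Real.dist_eq, abs_lt]
  constructor <;> linarith

theorem continuous_val {q : ℝ} (hq : 1 < q) : Continuous (val q : DigitSeq M → ℝ) :=
  continuous_iff_continuousAt.2 fun _ => tendsto_val hq tendsto_const_nhds tendsto_id

theorem continuous_drop (n : ℕ) : Continuous (drop n : DigitSeq M → DigitSeq M) := by
  rw [continuous_iff_continuousAt]
  intro c
  rw [ContinuousAt, Metric.tendsto_nhds]
  intro ε hε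
  obtain ⟨m, hm⟩ := exists_dist_lt_of_agree (M := M) hε
  filter_upwards [eventually_agree c (n + m)] with d hd
  exact hm _ _ fun i hi => hd _ (by omega)

theorem continuous_reflect : Continuous (reflect : DigitSeq M → DigitSeq M) := by
  rw [continuous_iff_continuousAt]
  intro c
  rw [ContinuousAt, Metric.tendsto_nhds]
  intro ε hε
  obtain ⟨m, hm⟩ := exists_dist_lt_of_agree (M := M) hε
  filter_upwards [eventually_agree c m] with d hd
  exact hm _ _ fun i hi => by simp [hd i hi]

/-! ### Numerical and lexicographic bounds on tails -/

/-- After every digit less than `M`, the remaining sequence has value at most `1`. -/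
def NumBound (q : ℝ) (c : DigitSeq M) : Prop :=
  ∀ n, c n ≠ Fin.last M → val q (c.drop (n + 1)) ≤ 1

/-- After every digit less than `M`, the remaining sequence has value less than `1`. -/
def StrictNumBound (q : ℝ) (c : DigitSeq M) : Prop :=
  ∀ n, c n ≠ Fin.last M → val q (c.drop (n + 1)) < 1

/-- After every digit less than `M`, the remaining sequence is at most `a`. -/
def LexBound (a c : DigitSeq M) : Prop := ∀ n, c n ≠ Fin.last M → c.drop (n + 1) ≤ a

/-- After every digit less than `M`, the remaining sequence is less than `a`. -/
def StrictLexBound (a c : DigitSeq M) : Prop := ∀ n, c n ≠ Fin.last M → c.drop (n + 1) < a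

theorem StrictNumBound.numBound {q : ℝ} {c : DigitSeq M} (h : StrictNumBound q c) :
    NumBound q c := fun n hn => (h n hn).le

theorem StrictLexBound.lexBound {a c : DigitSeq M} (h : StrictLexBound a c) :
    LexBound a c := fun n hn => (h n hn).le

theorem cast_add_one_le {x y : Fin (M + 1)} (h : x < y) : ((x : ℕ) : ℝ) + 1 ≤ (y : ℕ) := by
  exact_mod_cast Nat.succ_le_of_lt (Fin.lt_def.1 h)

theorem ne_last_of_lt {x y : Fin (M + 1)} (h : x < y) : x ≠ Fin.last M :=
  (h.trans_le (Fin.le_last y)).ne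

theorem ne_zero_of_lt {x y : Fin (M + 1)} (h : x < y) : y ≠ 0 :=
  ((Fin.zero_le x).trans_lt h).ne'

theorem isInfinite_iff {q : ℝ} (hq : 1 < q) {c : DigitSeq M} :
    c.IsInfinite ↔ ∀ n, c n ≠ 0 → 0 < val q (c.drop (n + 1)) := by
  refine forall_congr' fun n => imp_congr_right fun _ => ?_
  rw [val_pos_iff hq]
  constructor
  · rintro ⟨m, h1, h2⟩
    exact ⟨m - (n + 1), by rwa [drop_apply, Nat.add_sub_cancel' h1]⟩
  · rintro ⟨m, h⟩
    exact ⟨n + 1 + m, by omega, h⟩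

theorem IsInfinite.drop {c : DigitSeq M} (h : c.IsInfinite) (n : ℕ) : (c.drop n).IsInfinite := by
  intro i hi
  obtain ⟨m, h1, h2⟩ := h (n + i) hi
  exact ⟨m - n, by omega, by rwa [drop_apply, Nat.add_sub_cancel' (by omega)]⟩

theorem IsInfinite.val_drop_pos {q : ℝ} (hq : 1 < q) {c : DigitSeq M} (h : c.IsInfinite)
    (hc : 0 < val q c) (n : ℕ) : 0 < val q (c.drop n) := by
  induction n with
  | zero => simpa
  | succ n ih =>
    by_cases h0 : c n = 0
    · have := mul_val_drop hq c n
      rw [h0] at this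
      simp only [Fin.val_zero, Nat.cast_zero, zero_add] at this
      rw [← this]
      exact mul_pos (by linarith) ih
    · exact (isInfinite_iff hq).1 h n h0

theorem one_add_val_sub_le {q : ℝ} (hq : 1 < q) {a x : DigitSeq M} {j : ℕ}
    (h : ∀ i < j, x i = a i) (hj : x j < a j) :
    1 + val q (a.drop (j + 1)) - val q (x.drop (j + 1)) ≤ q ^ (j + 1) * (val q a - val q x) := by
  rw [pow_succ_mul_val_sub hq fun i hi => (h i hi).symm]
  have := cast_add_one_le hj
  linarith

/-- Where a tail first drops below `a`, its excess over `1`, multiplied by a power of `q`, is at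
most the excess of a later tail that again follows a digit less than `M`. Iterating from the crude
bound `G` divides the possible excess by `q` each time, so it is zero. -/
theorem LexBound.numBound {q : ℝ} (hq : 1 < q) {a c : DigitSeq M} (ha : val q a = 1)
    (h : LexBound a c) : NumBound q c := by
  have hq0 : 0 < q := by linarith
  set G : ℝ := M / (q - 1) with hG
  have hG0 : 0 ≤ G := (val_nonneg hq a).trans (val_le hq a)
  have key : ∀ k : ℕ, ∀ n, c n ≠ Fin.last M → val q (c.drop (n + 1)) ≤ 1 + G / q ^ k := by
    intro k
    induction k with
    | zero =>
      intro n _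
      have := val_le hq (c.drop (n + 1))
      simp only [pow_zero, div_one]
      linarith
    | succ k ih =>
      intro n hn
      rcases (h n hn).eq_or_lt with h1 | h1
      · rw [h1, ha]
        have : 0 ≤ G / q ^ (k + 1) := by positivity
        linarith
      · obtain ⟨j, h2, h3⟩ := lt_iff.1 h1
        have h4 := one_add_val_sub_le hq h2 h3
        have h5 := ih (n + 1 + j) (ne_last_of_lt h3)
        rw [drop_drop, ha] at h4
        rw [add_assoc (n + 1) j 1] at h5
        have h6 := val_nonneg hq (a.drop (j + 1))
        set v := val q (c.drop (n + 1))
        have h7 : q ^ (j + 1) * (v - 1) ≤ G / q ^ k := by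
          have : q ^ (j + 1) * (1 - v) = - (q ^ (j + 1) * (v - 1)) := by ring
          rw [this] at h4
          linarith
        have h8 : q ≤ q ^ (j + 1) := le_self_pow₀ hq.le (by omega)
        by_contra! hv
        have h9 : G / q ^ (k + 1) < v - 1 := by linarith
        have h10 : 0 ≤ G / q ^ (k + 1) := by positivity
        have h11 : q * (v - 1) ≤ q ^ (j + 1) * (v - 1) :=
          mul_le_mul_of_nonneg_right h8 (by linarith)
        have h12 : q * (G / q ^ (k + 1)) = G / q ^ k := by
          rw [pow_succ]; field_simp
        have h13 := mul_lt_mul_of_pos_left h9 hq0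
        linarith
  intro n hn
  have hlim : Tendsto (fun k : ℕ => 1 + G / q ^ k) atTop (𝓝 (1 + 0)) :=
    tendsto_const_nhds.add (tendsto_const_nhds.div_atTop (tendsto_pow_atTop_atTop_of_one_lt hq))
  rw [add_zero] at hlim
  exact ge_of_tendsto' hlim fun k => key k n hn

theorem val_drop_le_pow_mul {q : ℝ} (hq : 1 < q) {a c : DigitSeq M} (ha : val q a = 1)
    (hc : NumBound q c) {n j : ℕ} (h : ∀ i < j, c (n + i) = a i) (hj : c (n + j) < a j) :
    val q (a.drop (j + 1)) ≤ q ^ (j + 1) * (1 - val q (c.drop n)) := by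
  have h1 := one_add_val_sub_le hq (x := c.drop n) h hj
  have h2 := hc (n + j) (ne_last_of_lt hj)
  rw [drop_drop, ha, ← add_assoc] at h1
  linarith

/-- The distance of the tail value from `1` is at least a scaled tail value of `a`, which is
positive because `a` is infinite. -/
theorem StrictLexBound.strictNumBound {q : ℝ} (hq : 1 < q) {a c : DigitSeq M} (ha : val q a = 1)
    (ha' : a.IsInfinite) (h : StrictLexBound a c) : StrictNumBound q c := by
  have hq0 : 0 < q := by linarith
  intro n hn
  obtain ⟨j, h1, h2⟩ := lt_iff.1 (h n hn)
  have h3 := val_drop_le_pow_mul hq ha (h.lexBound.numBound hq ha) h1 h2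
  have h4 := ha'.val_drop_pos hq (by rw [ha]; norm_num) (j + 1)
  have h5 := pos_of_mul_pos_right (h4.trans_le h3) (by positivity)
  linarith

/-- If `z` exceeded `a` first at `j`, the gain of a digit plus a positive tail of `z` would outweigh
the tail of `a`, which is at most `1`. -/
theorem le_of_val_le {q : ℝ} (hq : 1 < q) {a z : DigitSeq M} (ha : val q a = 1)
    (hab : NumBound q a) (hz : z.IsInfinite) (hz1 : val q z ≤ 1) : z ≤ a := by
  have hq0 : 0 < q := by linarith
  by_contra hlt
  obtain ⟨j, h1, h2⟩ := lt_iff.1 (not_le.1 hlt)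
  have h3 := one_add_val_sub_le hq h1 h2
  have h4 := hab j (ne_last_of_lt h2)
  have h5 := (isInfinite_iff hq).1 hz j (ne_zero_of_lt h2)
  rw [ha] at h3
  have h6 : q ^ (j + 1) * (val q z - 1) ≤ 0 :=
    mul_nonpos_of_nonneg_of_nonpos (by positivity) (by linarith)
  linarith

/-! ### Digit exchange and the quasi-greedy algorithm -/

/-- The sequence consisting of the first `n` digits of `c`, the digit `x` and the digits of `e`. -/
def splice (n : ℕ) (c : DigitSeq M) (x : Fin (M + 1)) (e : DigitSeq M) : DigitSeq M :=
  ⟨fun i => if i < n then c i else if i = n then x else e (i - (n + 1))⟩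

theorem splice_of_lt {n i : ℕ} {c e : DigitSeq M} {x : Fin (M + 1)} (h : i < n) :
    splice n c x e i = c i := by simp [splice, h]

theorem splice_self (n : ℕ) (c e : DigitSeq M) (x : Fin (M + 1)) : splice n c x e n = x := by
  simp [splice]

theorem splice_drop (n : ℕ) (c e : DigitSeq M) (x : Fin (M + 1)) :
    (splice n c x e).drop (n + 1) = e := by
  refine digit_ext fun i => ?_
  have h1 : ¬ n + 1 + i < n := by omega
  have h2 : ¬ n + 1 + i = n := by omega
  simp [splice, h1, h2]

theorem val_splice {q : ℝ} (hq : 1 < q) (n : ℕ) (c e : DigitSeq M) (x : Fin (M + 1))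
    (h : ((x : ℕ) : ℝ) + val q e = (c n : ℕ) + val q (c.drop (n + 1))) :
    val q (splice n c x e) = val q c := by
  have h1 := pow_succ_mul_val_sub hq (c := splice n c x e) (d := c) (n := n)
    fun i hi => splice_of_lt hi
  rw [splice_self, splice_drop] at h1
  have h2 : q ^ (n + 1) * (val q (splice n c x e) - val q c) = 0 := by linarith
  have h3 : q ^ (n + 1) ≠ 0 := pow_ne_zero _ (by linarith)
  have := (mul_eq_zero.1 h2).resolve_left h3
  linarith

theorem splice_isInfinite {q : ℝ} (hq : 1 < q) (n : ℕ) (c e : DigitSeq M) (x : Fin (M + 1))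
    (he : e.IsInfinite) (he0 : 0 < val q e) : (splice n c x e).IsInfinite := by
  intro i _
  have h := he.val_drop_pos hq he0 i
  obtain ⟨m, hm⟩ := (val_pos_iff hq).1 h
  refine ⟨n + 1 + (i + m), by omega, ?_⟩
  have : (splice n c x e).drop (n + 1) (i + m) = e (i + m) := by rw [splice_drop]
  rw [drop_apply] at this
  rw [this]
  exact hm

theorem splice_reflect (n : ℕ) (c e : DigitSeq M) (x : Fin (M + 1)) :
    (splice n c x e).reflect = splice n c.reflect x.rev e.reflect := by
  refine digit_ext fun i => ?_
  simp only [reflect_apply, splice]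
  split_ifs <;> rfl

/-- The next digit of the quasi-greedy algorithm. -/
noncomputable def quasiDigit (M : ℕ) (q y : ℝ) : Fin (M + 1) :=
  -- For `q * y > 0`, `⌈q * y⌉₊ - 1` is the largest integer strictly below `q * y`; strictness keeps
  -- every remainder positive, so the expansion is infinite.
  ⟨min M (⌈q * y⌉₊ - 1), Nat.lt_succ_of_le (min_le_left _ _)⟩

theorem quasiDigit_spec {q y : ℝ} (hq : 1 < q) (hqM : q ≤ M + 1) (hy : 0 < y)
    (hyG : y ≤ M / (q - 1)) :
    0 < q * y - (quasiDigit M q y : ℕ) ∧ q * y - (quasiDigit M q y : ℕ) ≤ M / (q - 1) ∧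
      (quasiDigit M q y ≠ Fin.last M → q * y - (quasiDigit M q y : ℕ) ≤ 1) := by
  have hq1 : 0 < q - 1 := by linarith
  have hqy : 0 < q * y := mul_pos (by linarith) hy
  have hG1 : 1 ≤ (M : ℝ) / (q - 1) := by rw [le_div_iff₀ hq1]; linarith
  have hceil : 0 < ⌈q * y⌉₊ := Nat.ceil_pos.2 hqy
  have hc1 : ((⌈q * y⌉₊ - 1 : ℕ) : ℝ) < q * y := Nat.lt_ceil.1 (by omega)
  have hv : (quasiDigit M q y : ℕ) = min M (⌈q * y⌉₊ - 1) := rfl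
  rcases le_or_gt M (⌈q * y⌉₊ - 1) with h | h
  · rw [min_eq_left h] at hv
    have h1 : (M : ℝ) ≤ ((⌈q * y⌉₊ - 1 : ℕ) : ℝ) := by exact_mod_cast h
    refine ⟨by rw [hv]; linarith, ?_, fun hne => absurd (Fin.ext hv) hne⟩
    rw [hv]
    -- `M / (q - 1)` is the fixed point of `y ↦ q * y - M`, so the upper bound on remainders is
    -- preserved.
    have h2 : (q - 1) * (M / (q - 1)) = M := by field_simp
    nlinarith
  · rw [min_eq_right h.le] at hv
    have h1 : q * y ≤ ((⌈q * y⌉₊ - 1 : ℕ) : ℝ) + 1 := by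
      have := Nat.le_ceil (q * y)
      have h3 : ((⌈q * y⌉₊ - 1 : ℕ) : ℝ) + 1 = (⌈q * y⌉₊ : ℕ) := by
        exact_mod_cast Nat.sub_add_cancel hceil
      linarith
    rw [hv]
    exact ⟨by linarith, by linarith, fun _ => by linarith⟩

theorem exists_infinite_numBound {q x : ℝ} (hq : 1 < q) (hqM : q ≤ M + 1) (hx : 0 < x)
    (hxG : x ≤ M / (q - 1)) :
    ∃ c : DigitSeq M, val q c = x ∧ c.IsInfinite ∧ NumBound q c := by
  let r : ℕ → ℝ := fun n => Nat.rec x (fun _ y => q * y - (quasiDigit M q y : ℕ)) n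
  have hr : ∀ n, r (n + 1) = q * r n - (quasiDigit M q (r n) : ℕ) := fun n => rfl
  have hpos : ∀ n, 0 < r n ∧ r n ≤ M / (q - 1) := by
    intro n
    induction n with
    | zero => exact ⟨hx, hxG⟩
    | succ n ih =>
      rw [hr]
      have := quasiDigit_spec hq hqM ih.1 ih.2
      exact ⟨this.1, this.2.1⟩
  let c : DigitSeq M := ⟨fun n => quasiDigit M q (r n)⟩
  have hc : ∀ n, c n = quasiDigit M q (r n) := fun n => rfl
  -- The right side stays bounded, so `x` is the value of `c`; the remainders are then exactly the
  -- tail values.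
  have herr : ∀ n, q ^ n * (r 0 - val q c) = r n - val q (c.drop n) := by
    intro n
    induction n with
    | zero => simp
    | succ n ih =>
      have := mul_val_drop hq c n
      rw [pow_succ, mul_comm (q ^ n) q, mul_assoc, ih, hr, ← hc]
      linarith
  have h0 : r 0 - val q c = 0 := by
    have hlim : Tendsto (fun n : ℕ => (M : ℝ) / (q - 1) / q ^ n) atTop (𝓝 0) :=
      tendsto_const_nhds.div_atTop (tendsto_pow_atTop_atTop_of_one_lt hq)
    have : |r 0 - val q c| ≤ 0 := by
      refine ge_of_tendsto' hlim fun n => ?_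
      have hqn : 0 < q ^ n := pow_pos (by linarith) n
      rw [le_div_iff₀ hqn]
      nth_rewrite 1 [← abs_of_pos hqn]
      rw [← abs_mul, mul_comm, herr, abs_le]
      have h1 := hpos n
      have := val_nonneg hq (c.drop n)
      have := val_le hq (c.drop n)
      constructor <;> linarith
    exact abs_nonpos_iff.1 this
  have hval : ∀ n, val q (c.drop n) = r n := by
    intro n
    have := herr n
    rw [h0, mul_zero] at this
    linarith
  refine ⟨c, (congrArg (val q) (drop_zero c)).symm.trans (hval 0),
    (isInfinite_iff hq).2 fun n _ => ?_, fun n hn => ?_⟩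
  · rw [hval]; exact (hpos (n + 1)).1
  · rw [hval, hr]
    exact (quasiDigit_spec hq hqM (hpos n).1 (hpos n).2).2.2 hn

theorem isQuasiGreedy_of_numBound {q x : ℝ} (hq : 1 < q) {c : DigitSeq M} (hx : val q c = x)
    (hc : c.IsInfinite) (hb : NumBound q c) : c.IsQuasiGreedy q x := by
  refine ⟨(isExpansion_iff hq).2 hx, hc, fun d hd hdi => ?_⟩
  rw [isExpansion_iff hq] at hd
  rw [lexLE_iff]
  by_contra hlt
  obtain ⟨j, h1, h2⟩ := lt_iff.1 (not_le.1 hlt)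
  have h3 := one_add_val_sub_le hq h1 h2
  rw [hx, hd, sub_self, mul_zero] at h3
  have h4 := hb j (ne_last_of_lt h2)
  have h5 := (isInfinite_iff hq).1 hdi j (ne_zero_of_lt h2)
  linarith

theorem IsQuasiGreedy.unique {q x : ℝ} {c d : DigitSeq M} (hc : c.IsQuasiGreedy q x)
    (hd : d.IsQuasiGreedy q x) : c = d :=
  le_antisymm (lexLE_iff.1 (hd.2.2 c hc.1 hc.2.1)) (lexLE_iff.1 (hc.2.2 d hd.1 hd.2.1))

/-- The algorithm produces an infinite expansion with this bound, and such an expansion is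
quasi-greedy, so uniqueness applies. The value `0` and the bases above `M + 1` lie outside its reach
and are trivial. -/
theorem IsQuasiGreedy.numBound {q x : ℝ} (hq : 1 < q) {c : DigitSeq M}
    (hc : c.IsQuasiGreedy q x) : NumBound q c := by
  have hx := (isExpansion_iff hq).1 hc.1
  have hq1 : 0 < q - 1 := by linarith
  rcases le_or_gt q (M + 1) with hqM | hqM
  · rcases (val_nonneg hq c).eq_or_lt with h | h
    · intro n _
      have h0 : val q (c.drop (n + 1)) = 0 :=
        (val_eq_zero_iff hq).2 fun i => (val_eq_zero_iff hq).1 h.symm _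
      rw [h0]; norm_num
    · obtain ⟨d, h1, h2, h3⟩ := exists_infinite_numBound hq hqM h (val_le hq c)
      rw [hc.unique (isQuasiGreedy_of_numBound hq (h1.trans hx) h2 h3)]
      exact h3
  · intro n _
    refine (val_le hq _).trans ?_
    rw [div_le_one hq1]; linarith

/-- For `q < M + 1` the tail `M^∞` has value greater than `1`, so it cannot follow a digit less than
`M`. -/
theorem reflect_isInfinite {q : ℝ} (hq : 1 < q) (hqM : q < M + 1) {c : DigitSeq M}
    (hc : NumBound q c) : c.reflect.IsInfinite := by
  rw [isInfinite_iff hq]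
  intro n hn
  have h1 := hc n (rev_ne_zero.1 hn)
  have h2 : 1 < (M : ℝ) / (q - 1) := by rw [one_lt_div (by linarith)]; linarith
  rw [← reflect_drop, val_reflect hq]
  linarith

/-- `c` is the quasi-greedy expansion of `1`, in terms of values. -/
structure IsQuasiGreedyOne (q : ℝ) (a : DigitSeq M) : Prop where
  val_eq : val q a = 1
  isInfinite : a.IsInfinite
  numBound : NumBound q a

theorem isQuasiGreedyOne_iff {q : ℝ} (hq : 1 < q) {a : DigitSeq M} :
    IsQuasiGreedyOne q a ↔ a.IsQuasiGreedy q 1 :=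
  ⟨fun h => isQuasiGreedy_of_numBound hq h.1 h.2 h.3,
    fun h => ⟨(isExpansion_iff hq).1 h.1, h.2.1, h.numBound hq⟩⟩

theorem IsQuasiGreedyOne.unique {q : ℝ} (hq : 1 < q) {a b : DigitSeq M}
    (ha : IsQuasiGreedyOne q a) (hb : IsQuasiGreedyOne q b) : a = b :=
  ((isQuasiGreedyOne_iff hq).1 ha).unique ((isQuasiGreedyOne_iff hq).1 hb)

theorem exists_isQuasiGreedyOne {q : ℝ} (hq : 1 < q) (hqM : q ≤ M + 1) :
    ∃ a : DigitSeq M, IsQuasiGreedyOne q a := by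
  obtain ⟨a, h1, h2, h3⟩ := exists_infinite_numBound (M := M) hq hqM one_pos
    (by rw [le_div_iff₀ (by linarith)]; linarith)
  exact ⟨a, h1, h2, h3⟩

theorem le_of_val_eq_one {q : ℝ} (hq : 1 < q) {a : DigitSeq M} (ha : val q a = 1) :
    q ≤ M + 1 := by
  have := val_le hq a
  rw [ha, le_div_iff₀ (by linarith)] at this
  linarith

theorem eq_top_of_val_eq_one {q : ℝ} (hq : 1 < q) (hqM : q = M + 1) {a : DigitSeq M}
    (ha : val q a = 1) : a = top M := by
  refine eq_top_of_val hq ?_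
  have : (M : ℝ) = q - 1 := by linarith
  rw [ha, this, div_self (by linarith)]

/-! ### `𝒰_q'`, `𝒱_q'`, `𝒱` and `𝒰` in terms of tail values -/

/-- The sequences `c` such that `c` and its reflection satisfy `NumBound`. -/
def twoSided (M : ℕ) (q : ℝ) : Set (DigitSeq M) := {c | NumBound q c ∧ NumBound q c.reflect}

theorem not_lt_of_val_eq {q : ℝ} (hq : 1 < q) {c d : DigitSeq M} (hc : StrictNumBound q c)
    (hd : val q d = val q c) : ¬ c < d := by
  intro hlt
  obtain ⟨j, h1, h2⟩ := lt_iff.1 hlt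
  have h3 := one_add_val_sub_le hq h1 h2
  rw [hd, sub_self, mul_zero] at h3
  have h4 := hc j (ne_last_of_lt h2)
  have h5 := val_nonneg hq (d.drop (j + 1))
  linarith

/-- If a tail after a digit less than `M` had value at least `1`, raising that digit by one and
re-expanding the tail value minus `1` would give a second expansion. -/
theorem strictNumBound_of_unique {q : ℝ} (hq : 1 < q) {c : DigitSeq M}
    (h : ∀ d : DigitSeq M, val q d = val q c → d = c) : StrictNumBound q c := by
  have hq1 : 0 < q - 1 := by linarith
  intro n hn
  by_contra! hge
  have hqM : q ≤ M + 1 := by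
    have := hge.trans (val_le hq _)
    rw [le_div_iff₀ hq1] at this
    linarith
  obtain ⟨e, he⟩ : ∃ e : DigitSeq M, val q e = val q (c.drop (n + 1)) - 1 := by
    rcases hge.eq_or_lt with h1 | h1
    · exact ⟨⟨fun _ => 0⟩, by rw [← h1, sub_self, val_eq_zero_iff hq]; exact fun _ => rfl⟩
    · have := val_le hq (c.drop (n + 1))
      obtain ⟨e, he, -⟩ := exists_infinite_numBound (M := M) hq hqM (sub_pos.2 h1) (by linarith)
      exact ⟨e, he⟩
  have hlt : (c n : ℕ) < M := Fin.val_lt_last hn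
  let x : Fin (M + 1) := ⟨c n + 1, by omega⟩
  have hx : ((x : ℕ) : ℝ) = (c n : ℕ) + 1 := by
    simp [x]
  have h2 := h _ (val_splice hq n c e x (by rw [hx, he]; ring))
  have h3 := splice_self n c e x
  rw [h2] at h3
  have := congrArg Fin.val h3
  simp [x] at this

theorem mem_univoqueSeqs_iff {q : ℝ} (hq : 1 < q) {c : DigitSeq M} :
    c ∈ univoqueSeqs M q ↔ StrictNumBound q c ∧ StrictNumBound q c.reflect := by
  constructor
  · rintro ⟨x, ⟨c', -, hu⟩, hc⟩
    have hu' : ∀ d : DigitSeq M, val q d = val q c → d = c := fun d hd =>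
      (hu d ((isExpansion_iff hq).2 (hd.trans ((isExpansion_iff hq).1 hc)))).trans
        (hu c hc).symm
    refine ⟨strictNumBound_of_unique hq hu', strictNumBound_of_unique hq fun d hd => ?_⟩
    rw [← hu' d.reflect (by rw [val_reflect hq, hd, val_reflect hq]; ring), reflect_reflect]
  · rintro ⟨h1, h2⟩
    refine ⟨val q c, ⟨c, (isExpansion_iff hq).2 rfl, fun d hd => ?_⟩, (isExpansion_iff hq).2 rfl⟩
    replace hd := (isExpansion_iff hq).1 hd
    rcases lt_trichotomy c d with h | h | h
    · exact absurd h (not_lt_of_val_eq hq h1 hd)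
    · exact h.symm
    · refine absurd (reflect_lt_reflect h) (not_lt_of_val_eq hq h2 ?_)
      rw [val_reflect hq, val_reflect hq, hd]

theorem mem_vSeqs_iff {q : ℝ} (hq : 1 < q) {c : DigitSeq M} :
    c ∈ vSeqs M q ↔ c.IsInfinite ∧ c ∈ twoSided M q := by
  have hpos : ∀ x : Fin (M + 1), 0 < x ↔ x.rev ≠ Fin.last M := fun x => by
    rw [rev_ne_last, Fin.pos_iff_ne_zero]
  constructor
  · rintro ⟨x, ⟨a, ha, hα⟩, hc⟩
    obtain rfl := hc.unique ha
    refine ⟨hc.2.1, hc.numBound hq, ?_⟩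
    rcases le_or_gt q (M + 1) with hqM | hqM
    · obtain ⟨α, h⟩ := exists_isQuasiGreedyOne (M := M) hq hqM
      refine LexBound.numBound hq h.val_eq fun n hn => ?_
      rw [← reflect_drop, ← lexLE_iff]
      exact hα α ((isQuasiGreedyOne_iff hq).1 h) n ((hpos _).2 hn)
    · intro n _
      refine (val_le hq _).trans ?_
      rw [div_le_one (by linarith)]; linarith
  · rintro ⟨h1, h2, h3⟩
    have hQ := isQuasiGreedy_of_numBound hq rfl h1 h2
    refine ⟨val q c, ⟨c, hQ, fun α hα n hn => ?_⟩, hQ⟩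
    rw [← isQuasiGreedyOne_iff hq] at hα
    rw [lexLE_iff]
    -- At `q = M + 1` the reflected tails may be finite, but there `α = M^∞` imposes nothing.
    rcases (le_of_val_eq_one hq hα.val_eq).eq_or_lt with hqM | hqM
    · rw [eq_top_of_val_eq_one hq hqM hα.val_eq]
      exact le_topSeq _
    · exact le_of_val_le hq hα.val_eq hα.numBound ((reflect_isInfinite hq hqM h2).drop (n + 1))
        (h3 n ((hpos _).1 hn))

theorem mem_twoSided_isInfinite {q : ℝ} (hq : 1 < q) (hqM : q < M + 1) {c : DigitSeq M}
    (hc : c ∈ twoSided M q) : c.IsInfinite := by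
  simpa using reflect_isInfinite hq hqM hc.2

/-- If the reflected bound fails after a nonzero digit, lowering that digit and re-expanding the
tail value plus `1` gives another doubly infinite expansion. If it holds, a smaller doubly infinite
expansion would need a tail `M^∞` to make up for its first lower digit. -/
theorem mem_vBases_iff {q : ℝ} {a : DigitSeq M} (hq : 1 < q) (ha : IsQuasiGreedyOne q a) :
    q ∈ vBases M ↔ a ∈ twoSided M q := by
  have hq1 : 0 < q - 1 := by linarith
  constructor
  · rintro ⟨-, c, -, hu⟩
    refine ⟨ha.numBound, ?_⟩
    by_contra hnot
    simp only [NumBound, not_forall, not_le] at hnot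
    obtain ⟨n, hn, hgt⟩ := hnot
    have hqM : q < M + 1 := by
      have := hgt.trans_le (val_le hq _)
      rw [lt_div_iff₀ hq1] at this
      linarith
    rw [← reflect_drop, val_reflect hq] at hgt
    have hn0 : a n ≠ 0 := rev_ne_last.1 hn
    obtain ⟨e, h1, h2, h3⟩ := exists_infinite_numBound (M := M) hq hqM.le
      (x := 1 + val q (a.drop (n + 1))) (by linarith [val_nonneg hq (a.drop (n + 1))])
      (by linarith)
    have hpos : 0 < (a n : ℕ) := Nat.pos_of_ne_zero fun h => hn0 (Fin.ext h)
    let x : Fin (M + 1) := ⟨a n - 1, by omega⟩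
    have hx : ((x : ℕ) : ℝ) + 1 = (a n : ℕ) := by
      exact_mod_cast Nat.sub_add_cancel hpos
    have hd : val q (splice n a x e) = 1 := by
      rw [val_splice hq n a e x (by rw [h1, ← hx]; ring), ha.val_eq]
    have hdi : (splice n a x e).IsDoublyInfinite := by
      refine ⟨splice_isInfinite hq n a e x h2
        (by rw [h1]; linarith [val_nonneg hq (a.drop (n + 1))]), ?_⟩
      rw [splice_reflect]
      exact splice_isInfinite hq n _ _ _ (reflect_isInfinite hq hqM h3)
        (by rw [val_reflect hq, h1]; linarith)
    have heq := (hu _ ⟨(isExpansion_iff hq).2 hd, hdi⟩).trans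
      (hu _ ⟨(isExpansion_iff hq).2 ha.val_eq, ha.isInfinite,
        reflect_isInfinite hq hqM ha.numBound⟩).symm
    have h4 := splice_self n a e x
    rw [heq] at h4
    have := congrArg Fin.val h4
    simp only [x] at this
    omega
  · rintro ⟨h1, h2⟩
    refine ⟨hq, a, ⟨(isExpansion_iff hq).2 ha.val_eq, ha.isInfinite, ?_⟩, ?_⟩
    · rcases (le_of_val_eq_one hq ha.val_eq).eq_or_lt with hqM | hqM
      · rw [eq_top_of_val_eq_one hq hqM ha.val_eq]
        intro n hn
        exact absurd rfl (rev_ne_zero.1 hn)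
      · exact reflect_isInfinite hq hqM h1
    · rintro c ⟨hc, hci, hcr⟩
      have hle := lexLE_iff.1 (((isQuasiGreedyOne_iff hq).1 ha).2.2 c hc hci)
      rw [isExpansion_iff hq] at hc
      by_contra hne
      obtain ⟨j, h3, h4⟩ := lt_iff.1 (lt_of_le_of_ne hle hne)
      have h5 := one_add_val_sub_le hq h3 h4
      rw [hc, ha.val_eq, sub_self, mul_zero] at h5
      have h6 := h2 j (rev_ne_last.2 (ne_zero_of_lt h4))
      rw [← reflect_drop, val_reflect hq] at h6
      have h7 := (isInfinite_iff hq).1 hcr j (rev_ne_zero.2 (ne_last_of_lt h4))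
      rw [← reflect_drop, val_reflect hq] at h7
      linarith

theorem exists_of_mem_vBases {q : ℝ} (h : q ∈ vBases M) :
    ∃ a : DigitSeq M, IsQuasiGreedyOne q a := by
  obtain ⟨hq, c, ⟨hc, -⟩, -⟩ := h
  exact exists_isQuasiGreedyOne hq (le_of_val_eq_one hq ((isExpansion_iff hq).1 hc))

theorem mem_univoqueBases_iff {q : ℝ} (hq : 1 < q) :
    q ∈ univoqueBases M ↔ ∃ c ∈ univoqueSeqs M q, val q c = 1 := by
  constructor
  · rintro ⟨-, h⟩
    obtain ⟨c, hc, -⟩ := id h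
    exact ⟨c, ⟨1, h, hc⟩, (isExpansion_iff hq).1 hc⟩
  · rintro ⟨c, ⟨x, hx, hc⟩, h1⟩
    have : x = 1 := ((isExpansion_iff hq).1 hc).symm.trans h1
    exact ⟨hq, this ▸ hx⟩

/-! ### Comparisons decided within finitely many digits -/

/-- `c < d`, and the first difference occurs among the first `t` digits. -/
def LtWithin (t : ℕ) (c d : DigitSeq M) : Prop := ∃ n < t, (∀ i < n, c i = d i) ∧ c n < d n

/-- After every digit less than `M`, the next `t` digits are smaller than those of `a`. -/
def BlockBound (t : ℕ) (a c : DigitSeq M) : Prop :=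
  ∀ n, c n ≠ Fin.last M → LtWithin t (c.drop (n + 1)) a

theorem LtWithin.lt {t : ℕ} {c d : DigitSeq M} (h : LtWithin t c d) : c < d := by
  obtain ⟨n, -, h1⟩ := h
  exact lt_iff.2 ⟨n, h1⟩

theorem LtWithin.mono {s t : ℕ} {c d : DigitSeq M} (h : LtWithin s c d) (hst : s ≤ t) :
    LtWithin t c d := by
  obtain ⟨n, h0, h1⟩ := h
  exact ⟨n, by omega, h1⟩

theorem LtWithin.congr {t : ℕ} {c d c' d' : DigitSeq M} (h : LtWithin t c d)
    (hc : ∀ i < t, c' i = c i) (hd : ∀ i < t, d' i = d i) : LtWithin t c' d' := by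
  obtain ⟨n, h0, h1, h2⟩ := h
  refine ⟨n, h0, fun i hi => ?_, ?_⟩
  · rw [hc i (by omega), hd i (by omega), h1 i hi]
  · rwa [hc n h0, hd n h0]

theorem exists_ltWithin {c d : DigitSeq M} (h : c < d) : ∃ t, LtWithin t c d := by
  obtain ⟨n, h1⟩ := lt_iff.1 h
  exact ⟨n + 1, n, n.lt_succ_self, h1⟩

theorem apply_le_of_le {c d : DigitSeq M} (h : c ≤ d) {j : ℕ} (hj : ∀ i < j, c i = d i) :
    c j ≤ d j := by
  by_contra hlt
  exact absurd (lt_iff.2 ⟨j, fun i hi => (hj i hi).symm, not_le.1 hlt⟩) (not_lt.2 h)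

theorem LtWithin.apply_lt {c d : DigitSeq M} {j : ℕ} (h : LtWithin (j + 1) c d)
    (hj : ∀ i < j, c i = d i) : c j < d j := by
  obtain ⟨n, h0, -, h2⟩ := h
  obtain rfl : n = j := by
    by_contra hne
    exact h2.ne (hj n (by omega))
  exact h2

theorem BlockBound.strictLexBound {t : ℕ} {a c : DigitSeq M} (h : BlockBound t a c) :
    StrictLexBound a c := fun n hn => (h n hn).lt

theorem lt_of_drop_lt {c d : DigitSeq M} {m : ℕ} (h : ∀ i < m, c i = d i)
    (hlt : c.drop m < d.drop m) : c < d := by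
  obtain ⟨n, h1, h2⟩ := lt_iff.1 hlt
  refine lt_iff.2 ⟨m + n, fun i hi => ?_, h2⟩
  rcases lt_or_ge i m with h3 | h3
  · exact h i h3
  · have := h1 (i - m) (by omega)
    simpa [Nat.add_sub_cancel' h3] using this

/-! ### Block bounds and values -/

theorem val_drop_add_le {q : ℝ} (hq : 1 < q) (c : DigitSeq M) (n k : ℕ) :
    val q (c.drop (n + k)) ≤ q ^ k * val q (c.drop n) := by
  induction k with
  | zero => simp
  | succ k ih =>
    have h1 := mul_val_drop hq c (n + k)
    have h2 : q * val q (c.drop (n + k)) ≤ q * (q ^ k * val q (c.drop n)) :=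
      mul_le_mul_of_nonneg_left ih (by linarith)
    have h3 : (0 : ℝ) ≤ (c (n + k) : ℕ) := by positivity
    rw [pow_succ, mul_comm (q ^ k) q, mul_assoc]
    rw [add_assoc] at h1
    linarith

/-- A gap below `1` that depends only on `a` and `t`, not on `c` or the position: this is what
survives a change of base. -/
theorem BlockBound.val_le {q : ℝ} (hq : 1 < q) {a c : DigitSeq M} (ha : val q a = 1) {t : ℕ}
    (h : BlockBound t a c) {n : ℕ} (hn : c n ≠ Fin.last M) :
    val q (c.drop (n + 1)) ≤ 1 - val q (a.drop t) / q ^ t := by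
  have hqt : ∀ k : ℕ, 0 < q ^ k := fun k => pow_pos (by linarith) k
  obtain ⟨j, h0, h1, h2⟩ := h n hn
  have h3 := val_drop_le_pow_mul hq ha (h.strictLexBound.lexBound.numBound hq ha) h1 h2
  have h4 := val_drop_add_le hq a (j + 1) (t - (j + 1))
  rw [Nat.add_sub_cancel' h0] at h4
  have h5 := h4.trans (mul_le_mul_of_nonneg_left h3 (hqt _).le)
  rw [← mul_assoc, ← pow_add, Nat.sub_add_cancel h0] at h5
  have h6 : val q (a.drop t) / q ^ t ≤ 1 - val q (c.drop (n + 1)) := by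
    rw [div_le_iff₀ (hqt t)]; linarith
  linarith

theorem eventually_strictNumBound_of_blockBound {q : ℝ} (hq : 1 < q) {a : DigitSeq M}
    (ha : IsQuasiGreedyOne q a) (t : ℕ) :
    ∀ᶠ p in 𝓝 q, ∀ c : DigitSeq M, BlockBound t a c → StrictNumBound p c := by
  have hpos : 0 < val q (a.drop t) / q ^ t :=
    div_pos (ha.isInfinite.val_drop_pos hq (by rw [ha.val_eq]; norm_num) t)
      (pow_pos (by linarith) t)
  filter_upwards [eventually_abs_val_sub_lt (M := M) hq hpos] with p hp c hc n hn
  have h1 := hc.val_le hq ha.val_eq hn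
  have h2 := (abs_lt.1 (hp (c.drop (n + 1)))).2
  linarith

/-! ### Sequences that are not strictly bounded below by their reflection -/

/-- If a tail of `c` agreed with `a` on `n + 1` digits, what follows would be less than `a.drop (n +
1)`. Its reflection would then exceed `a`, against the reflected bound after the nonzero digit `a
n`. -/
theorem blockBound_of_le_reflect_drop {a c : DigitSeq M} {n : ℕ} (hn : a n ≠ 0)
    (ha : a ≤ (a.drop (n + 1)).reflect) (hc : StrictLexBound a c)
    (hcr : StrictLexBound a c.reflect) : BlockBound (n + 1) a c := by
  intro m hm
  obtain ⟨j, h1, h2⟩ := lt_iff.1 (hc m hm)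
  by_contra hnot
  have hj : n + 1 ≤ j := by
    by_contra hlt
    exact hnot ⟨j, by omega, h1, h2⟩
  have h3 := reflect_lt_reflect (drop_lt_drop (m := n + 1) (fun i hi => h1 i (by omega)) (hc m hm))
  have h4 := hcr (m + 1 + n) (rev_ne_last.2 (by rw [← drop_apply, h1 n (by omega)]; exact hn))
  rw [drop_drop, reflect_drop (m + 1 + (n + 1))] at h3
  exact lt_irrefl _ ((h3.trans h4).trans_le ha)

theorem blockBound_of_lt_reflect_drop {a c : DigitSeq M} {n : ℕ} (hn : a n ≠ 0)
    (ha : a < (a.drop (n + 1)).reflect) (hc : LexBound a c)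
    (hcr : LexBound a c.reflect) : BlockBound (n + 1) a c := by
  have key : ∀ m, (∀ i ≤ n, c (m + 1 + i) = a i) →
      (c.drop (m + 1 + (n + 1))).reflect ≤ a := by
    intro m h1
    exact hcr (m + 1 + n) (rev_ne_last.2 (by rw [h1 n le_rfl]; exact hn))
  intro m hm
  rcases (hc m hm).eq_or_lt with heq | hlt
  · have h4 := key m fun i _ => by rw [← drop_apply, heq]
    rw [← drop_drop, heq] at h4
    exact absurd ha (not_lt.2 h4)
  obtain ⟨j, h1, h2⟩ := lt_iff.1 hlt
  by_contra hnot
  have hj : n + 1 ≤ j := by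
    by_contra hlt
    exact hnot ⟨j, by omega, h1, h2⟩
  have h3 := reflect_lt_reflect (drop_lt_drop (m := n + 1) (fun i hi => h1 i (by omega)) hlt)
  rw [drop_drop] at h3
  exact lt_irrefl _ ((h3.trans_le (key m fun i hi => h1 i (by omega))).trans ha)

theorem drop_eq_of_reflect_drop_eq {a : DigitSeq M} {k : ℕ} (h : (a.drop k).reflect = a) :
    a.drop (k + k) = a := by
  have h1 : a.drop k = a.reflect := by rw [← reflect_reflect (a.drop k), h]
  rw [← drop_drop, h1, ← reflect_drop, h]

/-- Here `a` alternates a block of length `n + 1` with its reflection. Agreement over one period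
would force `a < d` by the reflected bound after the first block; removing the period then gives a
tail of `d` above `a`, against the direct bound. -/
theorem not_agree_of_strictLexBound {a d : DigitSeq M} {n : ℕ} (hn : a n ≠ 0)
    (ha : (a.drop (n + 1)).reflect = a) (hd : StrictLexBound a d)
    (hdr : StrictLexBound a d.reflect) : ¬ ∀ i < n + 1 + (n + 1), d i = a i := by
  intro hag
  have h1 : (d.drop (n + 1)).reflect < a :=
    hdr n (rev_ne_last.2 (by rw [hag n (by omega)]; exact hn))
  have h2 : a.drop (n + 1) < d.drop (n + 1) := by
    rw [← ha] at h1
    have := reflect_lt_reflect h1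
    rw [ha, reflect_reflect] at this
    have h3 : a.reflect = a.drop (n + 1) := by
      rw [← reflect_reflect (a.drop (n + 1)), ha]
    rwa [h3] at this
  have h3 : a < d := lt_of_drop_lt (fun i hi => (hag i (by omega)).symm) h2
  have h4 := drop_lt_drop (m := n + 1 + (n + 1)) (fun i hi => (hag i hi).symm) h3
  rw [drop_eq_of_reflect_drop_eq ha] at h4
  have h5 : d (n + 1 + n) ≠ Fin.last M := by
    rw [hag _ (by omega), ← drop_apply, ← rev_ne_zero, ← reflect_apply, ha]
    exact hn
  exact lt_asymm h4 (hd _ h5)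

/-- The analogue for an expansion of `1` in a nearby base, where `d` is compared with its own tails
instead of with `a`. -/
theorem not_agree_of_strictLexBound_self {a d : DigitSeq M} {n : ℕ} (hn : a n ≠ 0)
    (ha : (a.drop (n + 1)).reflect = a) (hd : StrictLexBound d d)
    (hdr : StrictLexBound d d.reflect) : ¬ ∀ i < n + 1 + (n + 1), d i = a i := by
  intro hag
  have h1 : (d.drop (n + 1)).reflect < d :=
    hdr n (rev_ne_last.2 (by rw [hag n (by omega)]; exact hn))
  have h5 : d (n + 1 + n) ≠ Fin.last M := by
    rw [hag _ (by omega), ← drop_apply, ← rev_ne_zero, ← reflect_apply, ha]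
    exact hn
  have h2 : d.drop (n + 1 + (n + 1)) < d := hd _ h5
  rcases lt_trichotomy d a with h | h | h
  · have h3 := reflect_lt_reflect (drop_lt_drop (m := n + 1) (fun i hi => hag i (by omega)) h)
    rw [ha] at h3
    exact lt_asymm h (h3.trans h1)
  · rw [h, ha] at h1
    exact lt_irrefl _ h1
  · obtain ⟨j, h3, h4⟩ := lt_iff.1 h
    have hj : n + 1 + (n + 1) ≤ j := by
      by_contra hlt
      exact h4.ne (hag j (by omega)).symm
    have hper : ∀ i, a (n + 1 + (n + 1) + i) = a i := fun i => by
      rw [← drop_apply, drop_eq_of_reflect_drop_eq ha]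
    refine lt_asymm h2 (lt_iff.2 ⟨j - (n + 1 + (n + 1)), fun i hi => ?_, ?_⟩)
    · rw [drop_apply, ← h3 i (by omega), ← h3 _ (by omega), hper]
    · rw [drop_apply, Nat.add_sub_cancel' hj, ← h3 _ (by omega), ← hper, Nat.add_sub_cancel' hj]
      exact h4

/-! ### Extension of admissible words -/

/-- All tails of `a` are at most `a`, and their reflections are less than `a`. -/
structure IsStrict (a : DigitSeq M) : Prop where
  drop_le : ∀ n, a.drop n ≤ a
  reflect_drop_lt : ∀ n, (a.drop n).reflect < a

/-- The reflected suffixes of the prefix of `a` of length `t` are smaller than the prefixes of `a`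
of the same length. -/
structure IsGoodLength (a : DigitSeq M) (t : ℕ) : Prop where
  pos : 1 ≤ t
  ltWithin : ∀ i < t, LtWithin (t - i) (a.drop i).reflect a
  ltWithin_pred : LtWithin (t - 1) a.reflect a

/-- Take the first suffix whose comparison is undecided at length `m` and lengthen the prefix until
it is decided. Earlier suffixes were decided already; a later one still undecided would produce a
tail of `a` exceeding `a`. -/
theorem IsStrict.exists_isGoodLength {a : DigitSeq M} (h : IsStrict a) (m : ℕ) :
    ∃ t, m ≤ t ∧ IsGoodLength a t := by
  classical
  obtain ⟨s, hs⟩ := exists_ltWithin (h.reflect_drop_lt 0)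
  rw [drop_zero] at hs
  have main : ∀ m, 1 ≤ m → ∃ t, m ≤ t ∧ ∀ i < t, LtWithin (t - i) (a.drop i).reflect a := by
    intro m hm
    by_cases hgood : ∀ i < m, LtWithin (m - i) (a.drop i).reflect a
    · exact ⟨m, le_rfl, hgood⟩
    push Not at hgood
    obtain ⟨i, ⟨him, hi⟩, hmin⟩ : ∃ i, (i < m ∧ ¬ LtWithin (m - i) (a.drop i).reflect a) ∧
        ∀ i' < i, ¬ (i' < m ∧ ¬ LtWithin (m - i') (a.drop i').reflect a) :=
      ⟨Nat.find hgood, Nat.find_spec hgood, fun i' hi' => Nat.find_min hgood hi'⟩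
    obtain ⟨s, h1, h2⟩ := lt_iff.1 (h.reflect_drop_lt i)
    have hms : m - i ≤ s := by
      by_contra hlt
      exact hi ⟨s, by omega, h1, h2⟩
    refine ⟨i + s + 1, by omega, fun i' hi' => ?_⟩
    rcases lt_trichotomy i' i with h3 | rfl | h3
    · have := hmin i' h3
      push Not at this
      exact (this (by omega)).mono (by omega)
    · exact ⟨s, by omega, h1, h2⟩
    · obtain ⟨u, rfl⟩ := Nat.exists_eq_add_of_lt h3
      obtain ⟨r, h4, h5⟩ := lt_iff.1 (h.reflect_drop_lt (i + u + 1))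
      by_contra hnot
      have hr : i + s + 1 - (i + u + 1) ≤ r := by
        by_contra hlt
        exact hnot ⟨r, by omega, h4, h5⟩
      refine absurd (h.drop_le (u + 1)) (not_le.2 (lt_iff.2 ⟨s - (u + 1), fun x hx => ?_, ?_⟩))
      · have e1 := h4 x (by omega)
        have e2 := h1 (u + 1 + x) (by omega)
        simp only [reflect_apply, drop_apply] at e1 e2 ⊢
        rw [← e1, ← e2]
        congr 2; omega
      · have e1 := h4 (s - (u + 1)) (by omega)
        simp only [reflect_apply, drop_apply] at e1 h2 ⊢
        rw [show u + 1 + (s - (u + 1)) = s by omega, ← e1,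
          show i + u + 1 + (s - (u + 1)) = i + s by omega]
        exact h2
  obtain ⟨t, h1, h2⟩ := main (max m (s + 1)) (by omega)
  exact ⟨t, by omega, by omega, h2, hs.mono (by omega)⟩

/-- The one-sided admissibility of the word formed by the first `N` digits of `c`. -/
def HalfAdmissible (a : DigitSeq M) (t N : ℕ) (c : DigitSeq M) : Prop :=
  ∀ n j, n + 1 + j < N → c n ≠ Fin.last M → (∀ i < j, c (n + 1 + i) = a i) →
    c (n + 1 + j) ≤ a j ∧ (j + 1 = t → c (n + 1 + j) ≠ a j)

/-- The first `N` digits of `c` form a word in which, after a digit less than `M`, blocks are at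
most the corresponding prefix of `a`, and less than it for blocks of length `t`; the same is
required of the reflected word. -/
def Admissible (a : DigitSeq M) (t N : ℕ) (c : DigitSeq M) : Prop :=
  HalfAdmissible a t N c ∧ HalfAdmissible a t N c.reflect

theorem Admissible.reflect {a c : DigitSeq M} {t N : ℕ} (h : Admissible a t N c) :
    Admissible a t N c.reflect := ⟨h.2, by rw [reflect_reflect]; exact h.1⟩

theorem HalfAdmissible.congr {a c d : DigitSeq M} {t N : ℕ} (h : HalfAdmissible a t N c)
    (hd : ∀ i < N, d i = c i) : HalfAdmissible a t N d := by
  intro n j hj hn hm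
  rw [hd _ hj]
  rw [hd n (by omega)] at hn
  exact h n j hj hn fun i hi => by rw [← hd _ (by omega), hm i hi]

theorem HalfAdmissible.succ {a c e : DigitSeq M} {t N : ℕ} {x : Fin (M + 1)}
    (h : HalfAdmissible a t N c)
    (hx : ∀ n j, n + 1 + j = N → c n ≠ Fin.last M → (∀ i < j, c (n + 1 + i) = a i) →
      x ≤ a j ∧ (j + 1 = t → x ≠ a j)) : HalfAdmissible a t (N + 1) (splice N c x e) := by
  intro n j hj hn hm
  rw [splice_of_lt (by omega)] at hn
  have hm' : ∀ i < j, c (n + 1 + i) = a i := fun i hi => by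
    rw [← hm i hi, splice_of_lt (by omega)]
  rcases (Nat.lt_succ_iff.1 hj).lt_or_eq with h1 | h1
  · rw [splice_of_lt h1]
    exact h n j h1 hn hm'
  · rw [h1, splice_self]
    exact hx n j h1 hn hm'

theorem HalfAdmissible.length_lt {a c : DigitSeq M} {t N n l : ℕ} (ht : 1 ≤ t)
    (h : HalfAdmissible a t N c) (hl : n + 1 + l = N) (hn : c n ≠ Fin.last M)
    (hm : ∀ i < l, c (n + 1 + i) = a i) : l + 1 ≤ t := by
  by_contra hlt
  exact (h n (t - 1) (by omega) hn fun i hi => hm i (by omega)).2 (by omega)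
    (hm (t - 1) (by omega))

theorem HalfAdmissible.blockBound {a c : DigitSeq M} {t : ℕ} (ht : 1 ≤ t)
    (h : ∀ N, HalfAdmissible a t N c) : BlockBound t a c := by
  classical
  intro n hn
  have hex : ∃ j, c (n + 1 + j) ≠ a j ∧ j < t := by
    by_contra hcon
    push Not at hcon
    have hag : ∀ i < t, c (n + 1 + i) = a i := fun i hi => by
      by_contra hne
      exact absurd (hcon i hne) (not_le.2 hi)
    exact (h _ n (t - 1) (Nat.lt_succ_self _) hn fun i hi => hag i (by omega)).2 (by omega)
      (hag _ (by omega))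
  have hag : ∀ i < Nat.find hex, c (n + 1 + i) = a i := fun i hi => by
    by_contra hne
    exact Nat.find_min hex hi ⟨hne, hi.trans (Nat.find_spec hex).2⟩
  exact ⟨Nat.find hex, (Nat.find_spec hex).2, hag,
    lt_of_le_of_ne (h _ n (Nat.find hex) (Nat.lt_succ_self _) hn hag).1 (Nat.find_spec hex).1⟩

theorem LexBound.halfAdmissible {a c : DigitSeq M} {t N : ℕ} (h : LexBound a c) (hN : N ≤ t) :
    HalfAdmissible a t N c := fun n _ _ hn hm =>
  ⟨apply_le_of_le (h n hn) hm, fun _ => by omega⟩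

/-- Let `l` be the longest match with a prefix of `a` at the end of the word or of its reflection.
Append `a l`, or `a l - 1` if this would complete a block of length `t`. All shorter matches are, up
to reflection, suffixes of the longest one, so the tail inequalities of `a` handle them. -/
theorem Admissible.exists_succ_of_longest {a c : DigitSeq M} {t N l n : ℕ} (ha : IsStrict a)
    (ht : IsGoodLength a t) (hc : Admissible a t N c) (hl : n + 1 + l = N)
    (hn : c n ≠ Fin.last M) (hm : ∀ i < l, c (n + 1 + i) = a i)
    (hmax : ∀ n' j, n' + 1 + j = N → c n' ≠ Fin.last M → (∀ i < j, c (n' + 1 + i) = a i) → j ≤ l)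
    (hmax' : ∀ n' j, n' + 1 + j = N → c.reflect n' ≠ Fin.last M →
      (∀ i < j, c.reflect (n' + 1 + i) = a i) → j ≤ l) :
    ∃ x, Admissible a t (N + 1) (splice N c x c) := by
  have hlt := hc.1.length_lt ht.pos hl hn hm
  have hupper : ∀ n' j, n' + 1 + j = N → c n' ≠ Fin.last M →
      (∀ i < j, c (n' + 1 + i) = a i) → j ≤ l ∧ a l ≤ a j := by
    intro n' j h1 h2 h3
    have hj := hmax n' j h1 h2 h3
    refine ⟨hj, ?_⟩
    have := apply_le_of_le (ha.drop_le (l - j)) (j := j) fun i hi => by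
      rw [drop_apply, ← hm _ (by omega), ← h3 i hi]
      congr 1; omega
    rwa [drop_apply, Nat.sub_add_cancel hj] at this
  have hlower : ∀ n' j, n' + 1 + j = N → c.reflect n' ≠ Fin.last M →
      (∀ i < j, c.reflect (n' + 1 + i) = a i) →
      j ≤ l ∧ (∀ i < j, (a.drop (l - j)).reflect i = a i) ∧ (a l).rev ≤ a j := by
    intro n' j h1 h2 h3
    have hj := hmax' n' j h1 h2 h3
    have hag : ∀ i < j, (a.drop (l - j)).reflect i = a i := fun i hi => by
      rw [reflect_apply, drop_apply, ← hm _ (by omega), ← h3 i hi, reflect_apply]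
      congr 2; omega
    refine ⟨hj, hag, ?_⟩
    have := apply_le_of_le (ha.reflect_drop_lt (l - j)).le hag
    rwa [reflect_apply, drop_apply, Nat.sub_add_cancel hj] at this
  by_cases hlt' : l + 1 = t
  · have hal : a l ≠ 0 := by
      have := (ht.ltWithin l (by omega))
      rw [show t - l = 0 + 1 by omega] at this
      have h1 := this.apply_lt (by simp)
      rw [reflect_apply, drop_apply, add_zero] at h1
      intro h0
      rw [h0, Fin.rev_zero] at h1
      exact absurd h1 (not_lt.2 (Fin.le_last _))
    have hpos : 0 < (a l : ℕ) := Nat.pos_of_ne_zero fun h => hal (Fin.ext h)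
    let x : Fin (M + 1) := ⟨a l - 1, by omega⟩
    have hx : (x : ℕ) + 1 = a l := Nat.sub_add_cancel hpos
    refine ⟨x, hc.1.succ fun n' j h1 h2 h3 => ?_, ?_⟩
    · have h4 := hupper n' j h1 h2 h3
      have h5 := Fin.le_def.1 h4.2
      exact ⟨Fin.le_def.2 (by omega), fun _ he => by
        have := congrArg Fin.val he
        omega⟩
    · rw [splice_reflect]
      refine hc.2.succ fun n' j h1 h2 h3 => ?_
      obtain ⟨h4, h5, -⟩ := hlower n' j h1 h2 h3
      -- Lowering the digit raises its reflection by one; the good length supplies the strict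
      -- inequality that leaves room for this.
      have h6 := ht.ltWithin (l - j) (by omega)
      rw [show t - (l - j) = j + 1 by omega] at h6
      have h7 := h6.apply_lt h5
      rw [reflect_apply, drop_apply, Nat.sub_add_cancel h4, Fin.lt_def, Fin.val_rev] at h7
      have h8 := (a l).is_lt
      refine ⟨?_, fun h9 => ?_⟩
      · rw [Fin.le_def, Fin.val_rev]
        omega
      -- A reflected match of length `t - 1` would make the prefix of `a` of that length its own
      -- reflection.
      · obtain rfl : j = l := by omega
        obtain ⟨r, h10, -, h12⟩ := ht.ltWithin_pred
        have := h5 r (by omega)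
        rw [Nat.sub_self, drop_zero] at this
        exact absurd this h12.ne
  · refine ⟨a l, hc.1.succ fun n' j h1 h2 h3 => ?_, ?_⟩
    · have h4 := hupper n' j h1 h2 h3
      exact ⟨h4.2, fun h5 => by omega⟩
    · rw [splice_reflect]
      refine hc.2.succ fun n' j h1 h2 h3 => ?_
      have h4 := hlower n' j h1 h2 h3
      exact ⟨h4.2.2, fun h5 => by omega⟩

theorem IsStrict.last_ne_zero {a : DigitSeq M} (ha : IsStrict a) : Fin.last M ≠ 0 := by
  obtain ⟨n, -, h⟩ := lt_iff.1 (ha.reflect_drop_lt 0)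
  exact ((Fin.zero_le _).trans_lt (h.trans_le (Fin.le_last _))).ne'

theorem Admissible.exists_succ {a c : DigitSeq M} {t N : ℕ} (ha : IsStrict a)
    (ht : IsGoodLength a t) (hN : 1 ≤ N) (hc : Admissible a t N c) :
    ∃ x, Admissible a t (N + 1) (splice N c x c) := by
  classical
  let P : ℕ → Prop := fun l => ∃ n, n + 1 + l = N ∧
    ((c n ≠ Fin.last M ∧ ∀ i < l, c (n + 1 + i) = a i) ∨
      (c.reflect n ≠ Fin.last M ∧ ∀ i < l, c.reflect (n + 1 + i) = a i))
  -- The last digit and its reflection are not both `M`, so an empty match always exists.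
  have hP0 : P 0 := by
    refine ⟨N - 1, by omega, ?_⟩
    by_cases h : c (N - 1) = Fin.last M
    · right
      exact ⟨rev_ne_last.2 (by rw [h]; exact ha.last_ne_zero), by simp⟩
    · left
      exact ⟨h, by simp⟩
  have hspec := Nat.findGreatest_spec (P := P) (Nat.zero_le N) hP0
  have hle : ∀ j, P j → j ≤ Nat.findGreatest P N := fun j hj =>
    Nat.le_findGreatest (by obtain ⟨n, h, -⟩ := hj; omega) hj
  obtain ⟨n, h1, ⟨h2, h3⟩ | ⟨h2, h3⟩⟩ := hspec
  · exact hc.exists_succ_of_longest ha ht h1 h2 h3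
      (fun n' j k1 k2 k3 => hle j ⟨n', k1, Or.inl ⟨k2, k3⟩⟩)
      (fun n' j k1 k2 k3 => hle j ⟨n', k1, Or.inr ⟨k2, k3⟩⟩)
  · obtain ⟨x, hx⟩ := hc.reflect.exists_succ_of_longest ha ht h1 h2 h3
      (fun n' j k1 k2 k3 => hle j ⟨n', k1, Or.inr ⟨k2, k3⟩⟩)
      (fun n' j k1 k2 k3 => hle j ⟨n', k1, Or.inl ⟨by rwa [reflect_reflect] at k2,
        by rwa [reflect_reflect] at k3⟩⟩)
    refine ⟨x.rev, ?_⟩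
    have := hx.reflect
    rwa [splice_reflect, reflect_reflect] at this

theorem Admissible.exists_extension {a c : DigitSeq M} {t N : ℕ} (ha : IsStrict a)
    (ht : IsGoodLength a t) (hN : 1 ≤ N) (hc : Admissible a t N c) :
    ∃ d : DigitSeq M, (∀ i < N, d i = c i) ∧ BlockBound t a d ∧ BlockBound t a d.reflect := by
  choose! x hx using fun (k : ℕ) (e : DigitSeq M) (he : Admissible a t (N + k) e) =>
    he.exists_succ ha ht (by omega)
  let f : ℕ → DigitSeq M := fun k => Nat.rec c (fun k e => splice (N + k) e (x k e) e) k
  have hf : ∀ k, f (k + 1) = splice (N + k) (f k) (x k (f k)) (f k) := fun k => rfl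
  have hadm : ∀ k, Admissible a t (N + k) (f k) := by
    intro k
    induction k with
    | zero => exact hc
    | succ k ih => exact hx k (f k) ih
  have hag : ∀ k m i, i < N + k → f (k + m) i = f k i := by
    intro k m i hi
    induction m with
    | zero => rfl
    | succ m ih => rw [← add_assoc, hf, splice_of_lt (by omega), ih]
  let d : DigitSeq M := ⟨fun i => f (i + 1) i⟩
  have hd : ∀ k, ∀ i < N + k, d i = f k i := by
    intro k i hi
    rw [← hag k (i + 1) i hi, add_comm k, hag (i + 1) k i (by omega)]
  have hhalf : ∀ k, HalfAdmissible a t k d := fun k => by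
    intro n j hj
    exact (hadm k).1.congr (hd k) n j (by omega)
  have hhalf' : ∀ k, HalfAdmissible a t k d.reflect := fun k => by
    intro n j hj
    exact (hadm k).2.congr (fun i hi => by rw [reflect_apply, hd k i hi, reflect_apply]) n j
      (by omega)
  exact ⟨d, hd 0, HalfAdmissible.blockBound ht.pos hhalf, HalfAdmissible.blockBound ht.pos hhalf'⟩

/-- With `t ≥ N + 1`, no block of length `t` fits after a digit of the prefix of length `N + 1`, so
weak bounds already make that prefix admissible. -/
theorem IsStrict.exists_blockBound {a c : DigitSeq M} (ha : IsStrict a) (hc : LexBound a c)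
    (hcr : LexBound a c.reflect) (N : ℕ) :
    ∃ (t : ℕ) (d : DigitSeq M), (∀ i < N, d i = c i) ∧ BlockBound t a d ∧
      BlockBound t a d.reflect := by
  obtain ⟨t, ht, hg⟩ := ha.exists_isGoodLength (N + 1)
  obtain ⟨d, h1, h2⟩ := Admissible.exists_extension ha hg (N := N + 1) (by omega)
    ⟨hc.halfAdmissible ht, hcr.halfAdmissible ht⟩
  exact ⟨t, d, fun i hi => h1 i (by omega), h2⟩

/-! ### From value bounds to comparisons with `α(q)` -/

theorem reflect_mem_twoSided {q : ℝ} {c : DigitSeq M} (h : c ∈ twoSided M q) :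
    c.reflect ∈ twoSided M q := ⟨h.2, by rw [reflect_reflect]; exact h.1⟩

theorem univoqueSeqs_subset_twoSided {q : ℝ} (hq : 1 < q) :
    univoqueSeqs M q ⊆ twoSided M q := fun _ hc =>
  have h := (mem_univoqueSeqs_iff hq).1 hc
  ⟨h.1.numBound, h.2.numBound⟩

theorem lexBound_of_mem_twoSided {q : ℝ} (hq : 1 < q) {a c : DigitSeq M}
    (ha : IsQuasiGreedyOne q a) (hc : c ∈ twoSided M q) : LexBound a c := by
  intro n hn
  rcases (le_of_val_eq_one hq ha.val_eq).eq_or_lt with hqM | hqM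
  · rw [eq_top_of_val_eq_one hq hqM ha.val_eq]
    exact le_topSeq _
  · exact le_of_val_le hq ha.val_eq ha.numBound ((mem_twoSided_isInfinite hq hqM hc).drop (n + 1))
      (hc.1 n hn)

theorem strictLexBound_of_mem_univoqueSeqs {q : ℝ} (hq : 1 < q) {a c : DigitSeq M}
    (ha : IsQuasiGreedyOne q a) (hc : c ∈ univoqueSeqs M q) :
    StrictLexBound a c ∧ StrictLexBound a c.reflect := by
  have h := (mem_univoqueSeqs_iff hq).1 hc
  have h2 := univoqueSeqs_subset_twoSided hq hc
  refine ⟨fun n hn => lt_of_le_of_ne (lexBound_of_mem_twoSided hq ha h2 n hn) fun heq => ?_,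
    fun n hn => lt_of_le_of_ne
      (lexBound_of_mem_twoSided hq ha (reflect_mem_twoSided h2) n hn) fun heq => ?_⟩
  · exact (h.1 n hn).ne (by rw [heq, ha.val_eq])
  · exact (h.2 n hn).ne (by rw [heq, ha.val_eq])

theorem val_drop_succ_le {q : ℝ} (hq : 1 < q) (hqM : q ≤ M + 1) {c : DigitSeq M} {n : ℕ}
    (hn : c n = Fin.last M) (h : val q (c.drop n) ≤ 1) : val q (c.drop (n + 1)) ≤ 1 := by
  have h1 := mul_val_drop hq c n
  rw [hn, Fin.val_last] at h1
  have : q * val q (c.drop n) ≤ q * 1 := mul_le_mul_of_nonneg_left h (by linarith)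
  linarith

/-- The bounds concern only tails after suitable digits. They pass to all tails because removing a
digit `M` from a sequence of value at most `1` leaves value at most `q - M ≤ 1`. -/
theorem isStrict_of_strictLexBound {q : ℝ} (hq : 1 < q) {a : DigitSeq M}
    (ha : IsQuasiGreedyOne q a) (h : StrictLexBound a a.reflect) : IsStrict a := by
  have hq1 : 0 < q - 1 := by linarith
  have hqM := le_of_val_eq_one hq ha.val_eq
  have hnum := h.strictNumBound hq ha.val_eq ha.isInfinite
  have h1 : ∀ n, val q (a.drop n) ≤ 1 := by
    intro n
    induction n with
    | zero => rw [drop_zero, ha.val_eq]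
    | succ n ih =>
      by_cases hn : a n = Fin.last M
      · exact val_drop_succ_le hq hqM hn ih
      · exact ha.numBound n hn
  -- This is the value of `a.reflect`, the base case for reflected tails: after the nonzero first
  -- digit, the tail of `a` has value at most `1` and its reflection less than `1`.
  have hG : (M : ℝ) / (q - 1) - 1 < 1 := by
    have e1 := mul_val hq a
    rw [ha.val_eq] at e1
    have e2 := h1 1
    have hne : a 0 ≠ 0 := by
      intro h0
      rw [h0, Fin.val_zero, Nat.cast_zero] at e1
      linarith
    have e3 := hnum 0 (rev_ne_last.2 hne)
    rw [← reflect_drop, val_reflect hq, zero_add] at e3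
    have e4 : ((a 0 : ℕ) : ℝ) ≤ M := digit_le a 0
    by_contra! hcon
    linarith
  have h2 : ∀ n, val q (a.drop n).reflect < 1 := by
    intro n
    induction n with
    | zero => rw [drop_zero, val_reflect hq, ha.val_eq]; exact hG
    | succ n ih =>
      by_cases hn : a n = 0
      · have e1 := mul_val_drop hq a.reflect n
        rw [reflect_apply, hn, Fin.rev_zero, Fin.val_last] at e1
        rw [reflect_drop] at ih ⊢
        have : q * val q (a.reflect.drop n) < q * 1 := mul_lt_mul_of_pos_left ih (by linarith)
        linarith
      · exact hnum n (rev_ne_last.2 hn)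
  rcases hqM.eq_or_lt with hqM | hqM
  · obtain rfl := eq_top_of_val_eq_one hq hqM ha.val_eq
    refine ⟨fun n => le_topSeq _, fun n => lt_of_le_of_ne (le_topSeq _) fun heq => ?_⟩
    have := h2 n
    rw [heq, ha.val_eq] at this
    exact lt_irrefl _ this
  · refine ⟨fun n => le_of_val_le hq ha.val_eq ha.numBound (ha.isInfinite.drop n) (h1 n),
      fun n => lt_of_le_of_ne (le_of_val_le hq ha.val_eq ha.numBound
        ((reflect_isInfinite hq hqM ha.numBound).drop n) (h2 n).le) fun heq => ?_⟩
    have := h2 n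
    rw [heq, ha.val_eq] at this
    exact lt_irrefl _ this

/-! ### Approximation by uniformly bounded sequences -/

theorem exists_blockBound_of_mem_univoqueSeqs {q : ℝ} (hq : 1 < q) {a c : DigitSeq M}
    (ha : IsQuasiGreedyOne q a) (hc : c ∈ univoqueSeqs M q) (N : ℕ) :
    ∃ (t : ℕ) (d : DigitSeq M), (∀ i < N, d i = c i) ∧ BlockBound t a d ∧
      BlockBound t a d.reflect := by
  obtain ⟨h1, h2⟩ := strictLexBound_of_mem_univoqueSeqs hq ha hc
  by_cases hs : StrictLexBound a a.reflect
  · exact (isStrict_of_strictLexBound hq ha hs).exists_blockBound h1.lexBound h2.lexBound N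
  · simp only [StrictLexBound, not_forall, not_lt] at hs
    obtain ⟨n, hn, hle⟩ := hs
    have hn0 := rev_ne_last.1 hn
    exact ⟨n + 1, c, fun _ _ => rfl, blockBound_of_le_reflect_drop hn0 hle h1 h2,
      blockBound_of_le_reflect_drop hn0 hle h2 (by rwa [reflect_reflect])⟩

theorem exists_blockBound_of_mem_twoSided {q : ℝ} (hq : 1 < q) {a c : DigitSeq M}
    (ha : IsQuasiGreedyOne q a) (haq : ¬ (a ∈ twoSided M q ∧ ¬ IsStrict a))
    (hc : c ∈ twoSided M q) (N : ℕ) :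
    ∃ (t : ℕ) (d : DigitSeq M), (∀ i < N, d i = c i) ∧ BlockBound t a d ∧
      BlockBound t a d.reflect := by
  have h1 := lexBound_of_mem_twoSided hq ha hc
  have h2 := lexBound_of_mem_twoSided hq ha (reflect_mem_twoSided hc)
  by_cases hs : IsStrict a
  · exact hs.exists_blockBound h1 h2 N
  · have hnot : ¬ LexBound a a.reflect := fun hlex =>
      haq ⟨⟨ha.numBound, hlex.numBound hq ha.val_eq⟩, hs⟩
    simp only [LexBound, not_forall, not_le] at hnot
    obtain ⟨n, hn, hlt⟩ := hnot
    have hn0 := rev_ne_last.1 hn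
    exact ⟨n + 1, c, fun _ _ => rfl, blockBound_of_lt_reflect_drop hn0 hlt h1 h2,
      blockBound_of_lt_reflect_drop hn0 hlt h2 (by rwa [reflect_reflect])⟩

theorem eventually_mem_univoqueSeqs_of_blockBound {q : ℝ} (hq : 1 < q) {a d : DigitSeq M}
    (ha : IsQuasiGreedyOne q a) {t : ℕ} (h1 : BlockBound t a d) (h2 : BlockBound t a d.reflect) :
    ∀ᶠ p in 𝓝 q, d ∈ univoqueSeqs M p := by
  filter_upwards [eventually_strictNumBound_of_blockBound hq ha t, lt_mem_nhds hq] with p hp hp1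
  exact (mem_univoqueSeqs_iff hp1).2 ⟨hp d h1, hp _ h2⟩

theorem univoqueSeqs_eq_univ {q : ℝ} (hq : M + 1 < q) : univoqueSeqs M q = univ := by
  have hM : (0 : ℝ) ≤ M := by positivity
  have hq1 : 1 < q := by linarith
  have key : ∀ c : DigitSeq M, StrictNumBound q c := fun c n _ =>
    (val_le hq1 _).trans_lt (by rw [div_lt_one (by linarith)]; linarith)
  exact eq_univ_of_forall fun c => (mem_univoqueSeqs_iff hq1).2 ⟨key _, key _⟩

/-! ### The closure of the univoque bases -/

theorem StrictLexBound.isInfinite {a e : DigitSeq M} (h : StrictLexBound a e.reflect) :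
    e.IsInfinite := by
  intro n hn
  by_contra! hcon
  have h1 := h n (rev_ne_last.2 hn)
  refine absurd (le_topSeq a) (not_le.2 ?_)
  convert h1
  refine digit_ext fun i => ?_
  rw [drop_apply, reflect_apply, hcon _ (by omega), Fin.rev_zero, top_apply]

theorem IsStrict.exists_ltWithin_of_periodic {a : DigitSeq M} (ha : IsStrict a) {k : ℕ}
    (hk : 0 < k) (hper : a.drop k = a) : ∃ L, ∀ m, LtWithin L (a.drop m).reflect a := by
  choose l hl using fun m => exists_ltWithin (ha.reflect_drop_lt m)
  have hp : Function.Periodic a.digit k := fun i => by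
    rw [add_comm i k, ← drop_apply, hper]
  refine ⟨(Finset.range k).sup l, fun m => ?_⟩
  have hmod : a.drop m = a.drop (m % k) := digit_ext fun i => by
    rw [drop_apply, drop_apply, ← hp.map_mod_nat (m + i), ← hp.map_mod_nat (m % k + i),
      Nat.mod_add_mod]
  rw [hmod]
  exact (hl _).mono (Finset.le_sup (Finset.mem_range.2 (Nat.mod_lt m hk)))

/-- A periodic `a` equals one of its tails. Lowering the last digit of a long prefix of good length
makes the comparisons inside the prefix strict, and a block bounded extension continues it. The
blocks are shorter than the part copied from `a`, so bounds by `a` are also bounds by `e`. -/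
theorem IsStrict.exists_strictLexBound_self {a : DigitSeq M} (ha : IsStrict a) {k : ℕ}
    (hk : 0 < k) (hper : a.drop k = a) (N : ℕ) :
    ∃ e : DigitSeq M, (∀ i < N, e i = a i) ∧ StrictLexBound e e ∧ StrictLexBound e e.reflect := by
  obtain ⟨L, hL⟩ := ha.exists_ltWithin_of_periodic hk hper
  obtain ⟨t, htL, ht⟩ := ha.exists_isGoodLength (L + 2)
  obtain ⟨T, hT1, hT⟩ := ha.exists_isGoodLength (max (t + 1) (N + 1))
  obtain ⟨S, rfl⟩ : ∃ S, T = S + L + 1 := ⟨T - L - 1, by omega⟩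
  have hlast : a (S + L) ≠ 0 := by
    have := hT.ltWithin (S + L) (by omega)
    rw [show S + L + 1 - (S + L) = 0 + 1 by omega] at this
    have h1 := this.apply_lt (by simp)
    rw [reflect_apply, drop_apply, add_zero] at h1
    intro h0
    rw [h0, Fin.rev_zero] at h1
    exact absurd h1 (not_lt.2 (Fin.le_last _))
  have hpos : 0 < (a (S + L) : ℕ) := Nat.pos_of_ne_zero fun h => hlast (Fin.ext h)
  let x : Fin (M + 1) := ⟨a (S + L) - 1, by omega⟩
  have hx : (x : ℕ) + 1 = a (S + L) := Nat.sub_add_cancel hpos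
  have hxlt : x < a (S + L) := Fin.lt_def.2 (by omega)
  let P := splice (S + L) a x a
  have hP : ∀ i < S + L, P i = a i := fun i hi => splice_of_lt hi
  have hPx : P (S + L) = x := splice_self _ _ _ _
  -- Only the last `L + 1` digits are passed to the extension: reflected tails starting at or before
  -- `S` are decided within `L` digits, and `t ≥ L + 2` rules out completed blocks here.
  have hadm : Admissible a t (L + 1) (P.drop S) := by
    constructor
    · intro n j hj hn hm
      refine ⟨?_, fun h => by omega⟩
      have hag : ∀ i < j, a.drop (S + (n + 1)) i = a i := fun i hi => by
        rw [← hm i hi, drop_apply, drop_apply, hP _ (by omega), add_assoc S]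
      have h1 := apply_le_of_le (ha.drop_le (S + (n + 1))) hag
      rw [drop_apply, add_assoc S] at h1
      rw [drop_apply]
      rcases (show S + (n + 1 + j) ≤ S + L by omega).lt_or_eq with h2 | h2
      · rwa [hP _ h2]
      · rw [h2] at h1 ⊢
        rw [hPx]
        exact hxlt.le.trans h1
    · intro n j hj hn hm
      refine ⟨?_, fun h => by omega⟩
      have hag : ∀ i < j, (a.drop (S + (n + 1))).reflect i = a i := fun i hi => by
        rw [← hm i hi, reflect_apply, reflect_apply, drop_apply, drop_apply, hP _ (by omega),
          add_assoc S]
      rw [reflect_apply, drop_apply]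
      rcases (show S + (n + 1 + j) ≤ S + L by omega).lt_or_eq with h2 | h2
      · have h1 := apply_le_of_le (ha.reflect_drop_lt (S + (n + 1))).le hag
        rw [reflect_apply, drop_apply, add_assoc S] at h1
        rwa [hP _ h2]
      · have h3 := hT.ltWithin (S + (n + 1)) (by omega)
        rw [show S + L + 1 - (S + (n + 1)) = j + 1 by omega] at h3
        have h4 := h3.apply_lt hag
        rw [reflect_apply, drop_apply, add_assoc S, h2, Fin.lt_def, Fin.val_rev] at h4
        rw [h2, hPx, Fin.le_def, Fin.val_rev]
        have := (a (S + L)).is_lt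
        omega
  obtain ⟨d, hd, hb, hbr⟩ := hadm.exists_extension ha ht (by omega)
  let e : DigitSeq M := ⟨fun i => if i < S then a i else d (i - S)⟩
  have he : ∀ i < S + L, e i = a i := by
    intro i hi
    by_cases h : i < S
    · simp [e, h]
    · have : e i = d (i - S) := by simp [e, h]
      rw [this, hd _ (by omega), drop_apply, Nat.add_sub_cancel' (not_lt.1 h), hP i hi]
  have hed : ∀ i, e (S + i) = d i := fun i => by simp [e]
  have hex : e (S + L) = x := by
    rw [hed, hd L (by omega), drop_apply, hPx]
  have hdrop : ∀ m, e.drop (S + m) = d.drop m := fun m => digit_ext fun i => by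
    rw [drop_apply, add_assoc, hed, drop_apply]
  refine ⟨e, fun i hi => he i (by omega), fun n hn => ?_, fun n hn => ?_⟩
  · rcases lt_or_ge (n + 1) (S + L + 1) with h1 | h1
    · rcases (show n + 1 ≤ S + L by omega).lt_or_eq with h2 | h2
      swap
      · have h0 : e 0 = a 0 := he 0 (by omega)
        refine lt_iff.2 ⟨0, by simp, ?_⟩
        rw [drop_apply, add_zero, h2, hex, h0]
        refine hxlt.trans_le ?_
        have := apply_le_of_le (ha.drop_le (S + L)) (j := 0) (by simp)
        simpa using this
      obtain ⟨s, hs⟩ := Nat.exists_eq_add_of_lt h2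
      by_cases hag : ∀ i < s + 1, a (n + 1 + i) = a i
      · have h3 := apply_le_of_le (ha.drop_le (n + 1)) (j := s + 1) hag
        rw [drop_apply, ← add_assoc, ← hs] at h3
        refine lt_iff.2 ⟨s + 1, fun i hi => ?_, ?_⟩
        · rw [drop_apply, he _ (by omega), he i (by omega), hag i hi]
        · rw [drop_apply, ← add_assoc, ← hs, hex, he _ (by omega)]
          exact hxlt.trans_le h3
      · rcases (ha.drop_le (n + 1)).eq_or_lt with h3 | h3
        · exact absurd (fun i _ => by rw [← drop_apply, h3]) hag
        obtain ⟨r, h4, h5⟩ := lt_iff.1 h3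
        have hr : r < s + 1 := by
          by_contra hle
          exact hag fun i hi => h4 i (by omega)
        rw [drop_apply] at h5
        refine lt_iff.2 ⟨r, fun i hi => ?_, ?_⟩
        · rw [drop_apply, he _ (by omega), he i (by omega)]
          exact h4 i hi
        · rwa [drop_apply, he _ (by omega), he r (by omega)]
    · obtain ⟨m, rfl⟩ := Nat.exists_eq_add_of_le (show S ≤ n by omega)
      rw [add_assoc, hdrop]
      rw [hed] at hn
      exact ((hb m hn).congr (fun _ _ => rfl) fun i hi => he i (by omega)).lt
  · rcases le_or_gt (n + 1) S with h1 | h1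
    · exact ((hL (n + 1)).congr (fun i hi => by
        rw [drop_apply, reflect_apply, he _ (by omega), reflect_apply, drop_apply])
        fun i hi => he i (by omega)).lt
    · obtain ⟨m, rfl⟩ := Nat.exists_eq_add_of_le (show S ≤ n by omega)
      rw [reflect_apply, hed] at hn
      rw [add_assoc, ← reflect_drop, hdrop]
      exact ((hbr m hn).congr (fun _ _ => rfl) fun i hi => he i (by omega)).lt

theorem mem_univoqueBases_of_strictLexBound {q : ℝ} (hq : 1 < q) {e : DigitSeq M}
    (he : val q e = 1) (h1 : StrictLexBound e e) (h2 : StrictLexBound e e.reflect) :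
    q ∈ univoqueBases M :=
  (mem_univoqueBases_iff hq).2 ⟨e, (mem_univoqueSeqs_iff hq).2
    ⟨h1.strictNumBound hq he h2.isInfinite, h2.strictNumBound hq he h2.isInfinite⟩, he⟩

theorem IsStrict.mem_closure_univoqueBases {q : ℝ} (hq : 1 < q) {a : DigitSeq M}
    (ha : IsQuasiGreedyOne q a) (hs : IsStrict a) : q ∈ closure (univoqueBases M) := by
  by_cases hself : StrictLexBound a a
  · exact subset_closure (mem_univoqueBases_of_strictLexBound hq ha.val_eq hself
      fun n _ => hs.reflect_drop_lt (n + 1))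
  simp only [StrictLexBound, not_forall, not_lt] at hself
  obtain ⟨n, -, hle⟩ := hself
  -- Strictness fails only through equality, so `a` is periodic and has to be perturbed.
  have hper : a.drop (n + 1) = a := le_antisymm (hs.drop_le _) hle
  rw [Metric.mem_closure_iff]
  intro ε hε
  obtain ⟨δ, hδ0, hδε, hδ1⟩ : ∃ δ, 0 < δ ∧ δ < ε ∧ δ < q - 1 :=
    ⟨min ε (q - 1) / 2, by have := lt_min hε (sub_pos.2 hq); linarith,
      by have := min_le_left ε (q - 1); linarith,
      by have := min_le_right ε (q - 1); linarith⟩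
  have hq1 : 1 < q - δ := by linarith
  have hq2 : 1 < q + δ := by linarith
  have hne : ∃ n, a n ≠ 0 := (val_pos_iff hq).1 (by rw [ha.val_eq]; norm_num)
  have hv1 := val_lt_val hq1 (show q - δ < q by linarith) hne
  have hv2 := val_lt_val hq (show q < q + δ by linarith) hne
  rw [ha.val_eq] at hv1 hv2
  obtain ⟨N1, hN1⟩ := exists_agree_val_lt M hq1 (sub_pos.2 hv1)
  obtain ⟨N2, hN2⟩ := exists_agree_val_lt M hq2 (sub_pos.2 hv2)
  obtain ⟨e, he, h1, h2⟩ := hs.exists_strictLexBound_self n.succ_pos hper (max N1 N2)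
  have hw1 := (abs_lt.1 (hN1 e a fun i hi => he i (by omega))).1
  have hw2 := (abs_lt.1 (hN2 e a fun i hi => he i (by omega))).2
  have hcont : ContinuousOn (fun p => val p e) (Icc (q - δ) (q + δ)) := fun p hp =>
    ContinuousAt.continuousWithinAt (f := fun p => val p e)
      (tendsto_val (hq1.trans_le hp.1) tendsto_id tendsto_const_nhds)
  -- `e` is so close to `a` that its values at `q - δ` and `q + δ` still lie on either side of `1`.
  obtain ⟨p, hp, hpe⟩ := intermediate_value_Icc' (by linarith) hcont
    (show (1 : ℝ) ∈ Icc (val (q + δ) e) (val (q - δ) e) from ⟨by linarith, by linarith⟩)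
  refine ⟨p, mem_univoqueBases_of_strictLexBound (hq1.trans_le hp.1) hpe h1 h2, ?_⟩
  rw [Real.dist_eq, abs_lt]
  constructor <;> linarith [hp.1, hp.2]

/-- `q` belongs to `𝒱` and the quasi-greedy expansion of `1` is not strict. -/
def IsJump (M : ℕ) (q : ℝ) : Prop :=
  ∃ a : DigitSeq M, IsQuasiGreedyOne q a ∧ a ∈ twoSided M q ∧ ¬ IsStrict a

theorem exists_reflect_drop_eq {q : ℝ} (hq : 1 < q) {a : DigitSeq M} (ha : IsQuasiGreedyOne q a)
    (h1 : a ∈ twoSided M q) (h2 : ¬ IsStrict a) :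
    q < M + 1 ∧ ∃ n, a n ≠ 0 ∧ (a.drop (n + 1)).reflect = a := by
  have hns : ¬ StrictLexBound a a.reflect := fun h => h2 (isStrict_of_strictLexBound hq ha h)
  simp only [StrictLexBound, not_forall, not_lt] at hns
  obtain ⟨n, hn, hle⟩ := hns
  have heq : (a.drop (n + 1)).reflect = a :=
    le_antisymm (lexBound_of_mem_twoSided hq ha (reflect_mem_twoSided h1) n hn) hle
  have hn0 := rev_ne_last.1 hn
  refine ⟨lt_of_le_of_ne (le_of_val_eq_one hq ha.val_eq) fun hqM => ?_, n, hn0, heq⟩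
  obtain rfl := eq_top_of_val_eq_one hq hqM ha.val_eq
  have := congrArg (fun c : DigitSeq M => c 0) heq
  simp only [reflect_apply, drop_apply, top_apply, Fin.rev_last] at this
  exact hn0 this.symm

theorem NumBound.of_tendsto {ι : Type*} {l : Filter ι} [l.NeBot] {p : ι → ℝ}
    {c : ι → DigitSeq M} {q : ℝ} {d : DigitSeq M} (hq : 1 < q) (hp : Tendsto p l (𝓝 q))
    (hc : Tendsto c l (𝓝 d)) (h : ∀ i, NumBound (p i) (c i)) : NumBound q d := by
  intro n hn
  refine le_of_tendsto (tendsto_val hq hp ((continuous_drop (n + 1)).continuousAt.tendsto.comp hc))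
    ?_
  filter_upwards [hc.eventually (eventually_agree d (n + 1))] with i hi
  exact h i n (by rwa [hi n n.lt_succ_self])

theorem IsJump.notMem_closure {q : ℝ} (hq : 1 < q) (h : IsJump M q) :
    q ∉ closure (univoqueBases M) := by
  obtain ⟨a, ha, h1, h2⟩ := h
  obtain ⟨hqM, n, hn, heq⟩ := exists_reflect_drop_eq hq ha h1 h2
  intro hcl
  obtain ⟨u, hu, hlim⟩ := mem_closure_iff_seq_limit.1 hcl
  choose c hc hc1 using fun i => (mem_univoqueBases_iff (hu i).1).1 (hu i)
  obtain ⟨d, -, φ, hφ, hd⟩ := isCompact_univ.tendsto_subseq (fun i => mem_univ (c i))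
  have hlim' := hlim.comp hφ.tendsto_atTop
  have htw : ∀ i, c i ∈ twoSided M (u i) := fun i =>
    univoqueSeqs_subset_twoSided (hu i).1 (hc i)
  have hdb : NumBound q d := NumBound.of_tendsto hq hlim' hd fun i => (htw (φ i)).1
  have hdr : NumBound q d.reflect := NumBound.of_tendsto hq hlim'
    (continuous_reflect.continuousAt.tendsto.comp hd) fun i => (htw (φ i)).2
  have hdv : val q d = 1 :=
    tendsto_nhds_unique (tendsto_val hq hlim' hd) (by simp [hc1])
  -- The limit of the unique expansions of `1` satisfies the closed bounds, so it is `α(q)`.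
  have hda : d = a := IsQuasiGreedyOne.unique hq
    ⟨hdv, mem_twoSided_isInfinite hq hqM ⟨hdb, hdr⟩, hdb⟩ ha
  rw [hda] at hd
  obtain ⟨i, hi1, hi2⟩ := ((hd.eventually (eventually_agree a (n + 1 + (n + 1)))).and
    (hlim'.eventually (gt_mem_nhds hqM))).exists
  have hself : IsQuasiGreedyOne (u (φ i)) (c (φ i)) :=
    ⟨hc1 _, mem_twoSided_isInfinite (hu _).1 hi2 (htw _), (htw _).1⟩
  obtain ⟨h3, h4⟩ := strictLexBound_of_mem_univoqueSeqs (hu _).1 hself (hc (φ i))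
  exact not_agree_of_strictLexBound_self hn heq h3 h4 hi1

theorem isJump_iff {q : ℝ} (hq : 1 < q) :
    IsJump M q ↔ q ∈ vBases M \ closure (univoqueBases M) := by
  constructor
  · intro h
    obtain ⟨a, ha, h1, -⟩ := id h
    exact ⟨(mem_vBases_iff hq ha).2 h1, h.notMem_closure hq⟩
  · rintro ⟨h1, h2⟩
    obtain ⟨a, ha⟩ := exists_of_mem_vBases h1
    exact ⟨a, ha, (mem_vBases_iff hq ha).1 h1, fun hs => h2 (hs.mem_closure_univoqueBases hq ha)⟩

/-! ### Monotonicity and semicontinuity -/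

theorem univoqueSeqs_mono {p q : ℝ} (hp : 1 < p) (hpq : p ≤ q) :
    univoqueSeqs M p ⊆ univoqueSeqs M q := by
  intro c hc
  rw [mem_univoqueSeqs_iff hp] at hc
  rw [mem_univoqueSeqs_iff (hp.trans_le hpq)]
  exact ⟨fun n hn => (val_anti hp hpq _).trans_lt (hc.1 n hn),
    fun n hn => (val_anti hp hpq _).trans_lt (hc.2 n hn)⟩

theorem twoSided_mono {p q : ℝ} (hp : 1 < p) (hpq : p ≤ q) : twoSided M p ⊆ twoSided M q :=
  fun _ hc => ⟨fun n hn => (val_anti hp hpq _).trans (hc.1 n hn),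
    fun n hn => (val_anti hp hpq _).trans (hc.2 n hn)⟩

theorem NumBound.strictNumBound_of_lt {p q : ℝ} (hp : 1 < p) (hpq : p < q) {c : DigitSeq M}
    (hc : NumBound p c) : StrictNumBound q c := by
  intro n hn
  by_cases h : ∃ i, c.drop (n + 1) i ≠ 0
  · exact (val_lt_val hp hpq h).trans_le (hc n hn)
  · push Not at h
    rw [(val_eq_zero_iff (hp.trans hpq)).2 h]
    exact one_pos

theorem twoSided_subset_univoqueSeqs {p q : ℝ} (hp : 1 < p) (hpq : p < q) :
    twoSided M p ⊆ univoqueSeqs M q := fun _ hc =>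
  (mem_univoqueSeqs_iff (hp.trans hpq)).2
    ⟨hc.1.strictNumBound_of_lt hp hpq, hc.2.strictNumBound_of_lt hp hpq⟩

/-- Below `M + 1` the bounds imply infiniteness; from `M + 1` on they are vacuous, and a tail `M^∞`
restores infiniteness. -/
theorem exists_vSeqs_agree {q : ℝ} (hq : 1 < q) (hM : 1 ≤ M) {c : DigitSeq M}
    (hc : c ∈ twoSided M q) (N : ℕ) : ∃ d ∈ vSeqs M q, ∀ i < N, d i = c i := by
  rcases lt_or_ge q (M + 1) with hqM | hqM
  · exact ⟨c, (mem_vSeqs_iff hq).2 ⟨mem_twoSided_isInfinite hq hqM hc, hc⟩, fun _ _ => rfl⟩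
  · have hlast : Fin.last M ≠ 0 := by
      rw [Ne, Fin.ext_iff]
      simp only [Fin.val_last, Fin.val_zero]
      omega
    have key : ∀ e : DigitSeq M, NumBound q e := fun e n _ =>
      (val_le hq _).trans (by rw [div_le_one (by linarith)]; linarith)
    refine ⟨splice N c (Fin.last M) (top M), (mem_vSeqs_iff hq).2 ⟨?_, key _, key _⟩,
      fun i hi => splice_of_lt hi⟩
    exact splice_isInfinite hq N c (top M) _ (fun n _ => ⟨n + 1, n.lt_succ_self, hlast⟩)
      ((val_pos_iff hq).2 ⟨0, hlast⟩)

/-- The condition depends on `c` only through its first `N` digits, so compactness makes the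
neighbourhood of bases uniform. -/
theorem eventually_forall_exists_agree {l : Filter ℝ} {A : Set (DigitSeq M)}
    {F : ℝ → Set (DigitSeq M)} (N : ℕ)
    (h : ∀ c ∈ A, ∀ᶠ p in l, ∃ d ∈ F p, ∀ i < N, d i = c i) :
    ∀ᶠ p in l, ∀ c ∈ A, ∃ d ∈ F p, ∀ i < N, d i = c i := by
  have key : ∀ᶠ p in l, ∀ c ∈ univ ∩ A, ∃ d ∈ F p, ∀ i < N, d i = c i := by
    refine isCompact_univ.induction_on
      (p := fun s => ∀ᶠ p in l, ∀ c ∈ s ∩ A, ∃ d ∈ F p, ∀ i < N, d i = c i) ?_ ?_ ?_ ?_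
    · simp
    · intro s t hst ht
      filter_upwards [ht] with p hp c hc
      exact hp c ⟨hst hc.1, hc.2⟩
    · intro s t hs ht
      filter_upwards [hs, ht] with p hp1 hp2 c hc
      exact hc.1.elim (fun h => hp1 c ⟨h, hc.2⟩) fun h => hp2 c ⟨h, hc.2⟩
    · intro c _
      refine ⟨{d | ∀ i < N, d i = c i}, by rw [nhdsWithin_univ]; exact eventually_agree c N, ?_⟩
      by_cases hex : ∃ c0 ∈ A, ∀ i < N, c0 i = c i
      · obtain ⟨c0, h0, h1⟩ := hex
        filter_upwards [h c0 h0] with p hp c' hc'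
        obtain ⟨d, hd, hd'⟩ := hp
        exact ⟨d, hd, fun i hi => by rw [hd' i hi, h1 i hi, hc'.1 i hi]⟩
      · exact Eventually.of_forall fun p c' hc' => absurd ⟨c', hc'.2, hc'.1⟩ hex
  simpa using key

theorem eventually_univoqueSeqs_agree {q : ℝ} (hq : 1 < q) (N : ℕ) :
    ∀ᶠ p in 𝓝 q, ∀ c ∈ univoqueSeqs M q, ∃ d ∈ univoqueSeqs M p, ∀ i < N, d i = c i := by
  refine eventually_forall_exists_agree N fun c hc => ?_
  rcases le_or_gt q (M + 1) with hqM | hqM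
  · obtain ⟨a, ha⟩ := exists_isQuasiGreedyOne (M := M) hq hqM
    obtain ⟨t, d, h1, h2, h3⟩ := exists_blockBound_of_mem_univoqueSeqs hq ha hc N
    filter_upwards [eventually_mem_univoqueSeqs_of_blockBound hq ha h2 h3] with p hp
    exact ⟨d, hp, h1⟩
  · filter_upwards [lt_mem_nhds hqM] with p hp
    exact ⟨c, by rw [univoqueSeqs_eq_univ hp]; trivial, fun _ _ => rfl⟩

theorem eventually_twoSided_agree_univoqueSeqs {q : ℝ} (hq : 1 < q) (hj : ¬ IsJump M q) (N : ℕ) :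
    ∀ᶠ p in 𝓝 q, ∀ c ∈ twoSided M q, ∃ d ∈ univoqueSeqs M p, ∀ i < N, d i = c i := by
  refine eventually_forall_exists_agree N fun c hc => ?_
  rcases le_or_gt q (M + 1) with hqM | hqM
  · obtain ⟨a, ha⟩ := exists_isQuasiGreedyOne (M := M) hq hqM
    obtain ⟨t, d, h1, h2, h3⟩ :=
      exists_blockBound_of_mem_twoSided hq ha (fun h => hj ⟨a, ha, h⟩) hc N
    filter_upwards [eventually_mem_univoqueSeqs_of_blockBound hq ha h2 h3] with p hp
    exact ⟨d, hp, h1⟩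
  · filter_upwards [lt_mem_nhds hqM] with p hp
    exact ⟨c, by rw [univoqueSeqs_eq_univ hp]; trivial, fun _ _ => rfl⟩

theorem eventually_not_numBound {q : ℝ} (hq : 1 < q) {c : DigitSeq M} (hc : ¬ NumBound q c) :
    ∀ᶠ x : ℝ × DigitSeq M in 𝓝 q ×ˢ 𝓝 c, ¬ NumBound x.1 x.2 := by
  simp only [NumBound, not_forall, not_le] at hc
  obtain ⟨n, hn, hgt⟩ := hc
  have h1 := (tendsto_val hq tendsto_fst
    ((continuous_drop (n + 1)).continuousAt.tendsto.comp tendsto_snd) :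
      Tendsto (fun x : ℝ × DigitSeq M => val x.1 (x.2.drop (n + 1))) (𝓝 q ×ˢ 𝓝 c) _)
  filter_upwards [h1.eventually (lt_mem_nhds hgt),
    tendsto_snd.eventually (eventually_agree c (n + 1))] with x hx1 hx2 hb
  exact absurd (hb n (by rwa [hx2 n n.lt_succ_self])) (not_le.2 hx1)

theorem eventually_notMem_twoSided {q : ℝ} (hq : 1 < q) {c : DigitSeq M}
    (hc : c ∉ twoSided M q) : ∀ᶠ x : ℝ × DigitSeq M in 𝓝 q ×ˢ 𝓝 c, x.2 ∉ twoSided M x.1 := by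
  by_cases h : NumBound q c
  · have hr : ¬ NumBound q c.reflect := fun hr => hc ⟨h, hr⟩
    have hlim : Tendsto (fun x : ℝ × DigitSeq M => (x.1, x.2.reflect)) (𝓝 q ×ˢ 𝓝 c)
        (𝓝 q ×ˢ 𝓝 c.reflect) :=
      tendsto_fst.prodMk (continuous_reflect.continuousAt.tendsto.comp tendsto_snd)
    filter_upwards [hlim.eventually (eventually_not_numBound hq hr)] with x hx hx'
    exact hx hx'.2
  · filter_upwards [eventually_not_numBound hq h] with x hx hx'
    exact hx hx'.1

theorem isClosed_twoSided {q : ℝ} (hq : 1 < q) : IsClosed (twoSided M q) := by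
  rw [← isOpen_compl_iff, isOpen_iff_mem_nhds]
  intro c hc
  have h := eventually_notMem_twoSided hq hc
  exact (h.curry.self_of_nhds : ∀ᶠ d in 𝓝 c, d ∉ twoSided M q)

/-- Upper semicontinuity: a sequence violating the bounds in base `q` has a neighbourhood all of
whose members violate them in every base near `q`; finitely many neighbourhoods cover the space. -/
theorem eventually_twoSided_agree {q : ℝ} (hq : 1 < q) (N : ℕ) :
    ∀ᶠ p in 𝓝 q, ∀ c ∈ twoSided M p, ∃ d ∈ twoSided M q, ∀ i < N, d i = c i := by
  have key : ∀ᶠ p in 𝓝 q, ∀ c ∈ univ ∩ twoSided M p,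
      ∃ d ∈ twoSided M q, ∀ i < N, d i = c i := by
    refine isCompact_univ.induction_on
      (p := fun s => ∀ᶠ p in 𝓝 q, ∀ c ∈ s ∩ twoSided M p,
        ∃ d ∈ twoSided M q, ∀ i < N, d i = c i) ?_ ?_ ?_ ?_
    · simp
    · intro s t hst ht
      filter_upwards [ht] with p hp c hc
      exact hp c ⟨hst hc.1, hc.2⟩
    · intro s t hs ht
      filter_upwards [hs, ht] with p hp1 hp2 c hc
      exact hc.1.elim (fun h => hp1 c ⟨h, hc.2⟩) fun h => hp2 c ⟨h, hc.2⟩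
    · intro c _
      rw [nhdsWithin_univ]
      by_cases hc : c ∈ twoSided M q
      · exact ⟨{d | ∀ i < N, d i = c i}, eventually_agree c N,
          Eventually.of_forall fun p d hd => ⟨c, hc, fun i hi => (hd.1 i hi).symm⟩⟩
      · obtain ⟨pa, hpa, pb, hpb, h⟩ := eventually_prod_iff.1 (eventually_notMem_twoSided hq hc)
        refine ⟨{d | pb d}, hpb, ?_⟩
        filter_upwards [hpa] with p hp d hd
        exact absurd hd.2 (h hp hd.1)
  simpa using key

/-! ### Hausdorff convergence -/

/-- For `p` along `l`, the elements of `F p` and of `F q` share arbitrarily long prefixes. -/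
def PrefixClose (F : ℝ → Set (DigitSeq M)) (l : Filter ℝ) (q : ℝ) : Prop :=
  ∀ N : ℕ, ∀ᶠ p in l, (∀ c ∈ F p, ∃ d ∈ F q, ∀ i < N, d i = c i) ∧
    ∀ c ∈ F q, ∃ d ∈ F p, ∀ i < N, d i = c i

theorem tendsto_hausdorffEDist_zero {X : Type*} [MetricSpace X] {F : ℝ → Set X} {l : Filter ℝ}
    {q : ℝ} (h : ∀ ε > 0, ∀ᶠ p in l, (∀ x ∈ F p, ∃ y ∈ F q, dist x y < ε) ∧
      ∀ y ∈ F q, ∃ x ∈ F p, dist y x < ε) :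
    Tendsto (fun p => Metric.hausdorffEDist (F p) (F q)) l (𝓝 0) := by
  rw [ENNReal.tendsto_nhds_zero]
  intro ε hε
  obtain ⟨δ, hδ, hδε⟩ : ∃ δ : ℝ, 0 < δ ∧ ENNReal.ofReal δ ≤ ε := by
    rcases eq_or_ne ε ⊤ with rfl | hne
    · exact ⟨1, one_pos, le_top⟩
    · exact ⟨ε.toReal, ENNReal.toReal_pos hε.ne' hne, by rw [ENNReal.ofReal_toReal hne]⟩
  filter_upwards [h δ hδ] with p hp
  refine (Metric.hausdorffEDist_le_of_mem_edist (fun x hx => ?_) fun y hy => ?_).trans hδε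
  · obtain ⟨y, hy, hxy⟩ := hp.1 x hx
    exact ⟨y, hy, by rw [edist_dist]; exact ENNReal.ofReal_le_ofReal hxy.le⟩
  · obtain ⟨x, hx, hxy⟩ := hp.2 y hy
    exact ⟨x, hx, by rw [edist_dist]; exact ENNReal.ofReal_le_ofReal hxy.le⟩

theorem PrefixClose.tendsto {F : ℝ → Set (DigitSeq M)} {l : Filter ℝ} {q : ℝ}
    (h : PrefixClose F l q) :
    Tendsto (fun p => Metric.hausdorffEDist (F p) (F q)) l (𝓝 0) := by
  refine tendsto_hausdorffEDist_zero fun ε hε => ?_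
  obtain ⟨N, hN⟩ := exists_dist_lt_of_agree (M := M) hε
  filter_upwards [h N] with p hp
  refine ⟨fun c hc => ?_, fun c hc => ?_⟩
  · obtain ⟨d, hd, hag⟩ := hp.1 c hc
    exact ⟨d, hd, hN _ _ fun i hi => (hag i hi).symm⟩
  · obtain ⟨d, hd, hag⟩ := hp.2 c hc
    exact ⟨d, hd, hN _ _ fun i hi => (hag i hi).symm⟩

theorem PrefixClose.tendsto_image {F : ℝ → Set (DigitSeq M)} {l : Filter ℝ} {q : ℝ}
    (h : PrefixClose F l q) (hq : 1 < q) (hl : l ≤ 𝓝 q) :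
    Tendsto (fun p => Metric.hausdorffEDist (val p '' F p) (val q '' F q)) l (𝓝 0) := by
  refine tendsto_hausdorffEDist_zero (F := fun p => val p '' F p) fun ε hε => ?_
  obtain ⟨N, hN⟩ := exists_agree_val_lt M hq (half_pos hε)
  filter_upwards [h N, hl (eventually_abs_val_sub_lt (M := M) hq (half_pos hε))] with p hp hp'
  refine ⟨?_, ?_⟩
  · rintro _ ⟨c, hc, rfl⟩
    obtain ⟨d, hd, hag⟩ := hp.1 c hc
    refine ⟨_, ⟨d, hd, rfl⟩, ?_⟩
    have h1 := abs_lt.1 (hN d c hag)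
    have h2 := abs_lt.1 (hp' c)
    rw [Real.dist_eq, abs_lt]
    constructor <;> linarith
  · rintro _ ⟨c, hc, rfl⟩
    obtain ⟨d, hd, hag⟩ := hp.2 c hc
    refine ⟨_, ⟨d, hd, rfl⟩, ?_⟩
    have h1 := abs_lt.1 (hN d c hag)
    have h2 := abs_lt.1 (hp' d)
    rw [Real.dist_eq, abs_lt]
    constructor <;> linarith

theorem univoqueNumbers_eq_image {q : ℝ} (hq : 1 < q) :
    univoqueNumbers M q = val q '' univoqueSeqs M q := by
  ext x
  constructor
  · intro hx
    obtain ⟨c, hc, -⟩ := id hx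
    exact ⟨c, ⟨x, hx, hc⟩, (isExpansion_iff hq).1 hc⟩
  · rintro ⟨c, ⟨y, hy, hc⟩, rfl⟩
    rwa [(isExpansion_iff hq).1 hc]

theorem vNumbers_eq_image {q : ℝ} (hq : 1 < q) : vNumbers M q = val q '' vSeqs M q := by
  ext x
  constructor
  · intro hx
    obtain ⟨c, hc, -⟩ := id hx
    exact ⟨c, ⟨x, hx, hc⟩, (isExpansion_iff hq).1 hc.1⟩
  · rintro ⟨c, ⟨y, hy, hc⟩, rfl⟩
    rwa [(isExpansion_iff hq).1 hc.1]

theorem PrefixClose.hausdorffContinuousWithinAt {F : ℝ → Set (DigitSeq M)} {G : ℝ → Set ℝ}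
    {s : Set ℝ} {q : ℝ} (h : PrefixClose F (𝓝[s] q) q) (hq : 1 < q)
    (hG : ∀ p, 1 < p → G p = val p '' F p) :
    HausdorffContinuousWithinAt F s q ∧ HausdorffContinuousWithinAt G s q := by
  refine ⟨h.tendsto, (h.tendsto_image hq nhdsWithin_le_nhds).congr' ?_⟩
  filter_upwards [nhdsWithin_le_nhds (lt_mem_nhds hq)] with p hp
  rw [hG p hp, hG q hq]

theorem prefixClose_univoqueSeqs_left {q : ℝ} (hq : 1 < q) :
    PrefixClose (univoqueSeqs M) (𝓝[Ioc 1 q] q) q := by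
  intro N
  filter_upwards [nhdsWithin_le_nhds (eventually_univoqueSeqs_agree (M := M) hq N),
    self_mem_nhdsWithin] with p hp hpq
  exact ⟨fun c hc => ⟨c, univoqueSeqs_mono hpq.1 hpq.2 hc, fun _ _ => rfl⟩, hp⟩

theorem prefixClose_vSeqs_right {q : ℝ} (hq : 1 < q) (hM : 1 ≤ M) :
    PrefixClose (vSeqs M) (𝓝[Ici q] q) q := by
  intro N
  filter_upwards [nhdsWithin_le_nhds (eventually_twoSided_agree (M := M) hq N),
    self_mem_nhdsWithin] with p hp hpq
  have hp1 : 1 < p := hq.trans_le hpq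
  refine ⟨fun c hc => ?_, fun c hc => ?_⟩
  · obtain ⟨d, hd, h1⟩ := hp c ((mem_vSeqs_iff hp1).1 hc).2
    obtain ⟨e, he, h2⟩ := exists_vSeqs_agree hq hM hd N
    exact ⟨e, he, fun i hi => by rw [h2 i hi, h1 i hi]⟩
  · exact exists_vSeqs_agree hp1 hM
      (twoSided_mono hq hpq ((mem_vSeqs_iff hq).1 hc).2) N

theorem prefixClose_univoqueSeqs {q : ℝ} (hq : 1 < q) (hj : ¬ IsJump M q) :
    PrefixClose (univoqueSeqs M) (𝓝[Ioi 1] q) q := by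
  intro N
  have hD := eventually_twoSided_agree_univoqueSeqs (M := M) hq hj N
  filter_upwards [nhdsWithin_le_nhds (eventually_twoSided_agree (M := M) hq N),
    nhdsWithin_le_nhds hD, self_mem_nhdsWithin] with p h1 h2 hp
  refine ⟨fun c hc => ?_, fun c hc => h2 c (univoqueSeqs_subset_twoSided hq hc)⟩
  obtain ⟨d, hd, h3⟩ := h1 c (univoqueSeqs_subset_twoSided hp hc)
  -- Taking `p = q` shows that `𝒰_q'` is dense in `twoSided M q` away from jumps.
  obtain ⟨e, he, h4⟩ := hD.self_of_nhds d hd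
  exact ⟨e, he, fun i hi => by rw [h4 i hi, h3 i hi]⟩

theorem prefixClose_vSeqs {q : ℝ} (hq : 1 < q) (hM : 1 ≤ M) (hj : ¬ IsJump M q) :
    PrefixClose (vSeqs M) (𝓝[Ioi 1] q) q := by
  intro N
  filter_upwards [nhdsWithin_le_nhds (eventually_twoSided_agree (M := M) hq N),
    nhdsWithin_le_nhds (eventually_twoSided_agree_univoqueSeqs (M := M) hq hj N),
    self_mem_nhdsWithin] with p h1 h2 hp
  refine ⟨fun c hc => ?_, fun c hc => ?_⟩
  · obtain ⟨d, hd, h3⟩ := h1 c ((mem_vSeqs_iff hp).1 hc).2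
    obtain ⟨e, he, h4⟩ := exists_vSeqs_agree hq hM hd N
    exact ⟨e, he, fun i hi => by rw [h4 i hi, h3 i hi]⟩
  · obtain ⟨d, hd, h3⟩ := h2 c ((mem_vSeqs_iff hq).1 hc).2
    obtain ⟨e, he, h4⟩ :=
      exists_vSeqs_agree hp hM (univoqueSeqs_subset_twoSided hp hd) N
    exact ⟨e, he, fun i hi => by rw [h4 i hi, h3 i hi]⟩

/-! ### Discontinuity -/

theorem exists_dist_lt_of_tendsto {X : Type*} [MetricSpace X] {F : ℝ → Set X} {l : Filter ℝ}
    {q : ℝ} (h : Tendsto (fun p => Metric.hausdorffEDist (F p) (F q)) l (𝓝 0)) {ε : ℝ}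
    (hε : 0 < ε) : ∀ᶠ p in l, (∀ x ∈ F p, ∃ y ∈ F q, dist x y < ε) ∧
      ∀ y ∈ F q, ∃ x ∈ F p, dist y x < ε := by
  filter_upwards [(tendsto_order.1 h).2 _ (ENNReal.ofReal_pos.2 hε)] with p hp
  refine ⟨fun x hx => ?_, fun y hy => ?_⟩
  · obtain ⟨y, hy, hxy⟩ := Metric.exists_edist_lt_of_hausdorffEDist_lt hx hp
    exact ⟨y, hy, by rwa [edist_dist, ENNReal.ofReal_lt_ofReal_iff hε] at hxy⟩
  · rw [Metric.hausdorffEDist_comm] at hp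
    obtain ⟨x, hx, hxy⟩ := Metric.exists_edist_lt_of_hausdorffEDist_lt hy hp
    exact ⟨x, hx, by rwa [edist_dist, ENNReal.ofReal_lt_ofReal_iff hε] at hxy⟩

theorem nhdsGT_le_nhdsWithin_Ioi {r q : ℝ} (h : r ≤ q) : 𝓝[>] q ≤ 𝓝[Ioi r] q :=
  nhdsWithin_mono q (Ioi_subset_Ioi h)

theorem nhdsLT_le_nhdsWithin_Ioi {r q : ℝ} (h : r < q) : 𝓝[<] q ≤ 𝓝[Ioi r] q := by
  rw [isOpen_Ioi.nhdsWithin_eq h]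
  exact nhdsWithin_le_nhds

/-- A sequence in `𝒱_q'` and its value that are isolated from `𝒰_q'` and `𝒰_q`. -/
theorem IsJump.exists_isolated {q : ℝ} (hq : 1 < q) (h : IsJump M q) :
    ∃ a ∈ vSeqs M q, a ∉ closure (univoqueSeqs M q) ∧
      val q a ∉ closure (val q '' univoqueSeqs M q) := by
  obtain ⟨a, ha, h1, h2⟩ := h
  obtain ⟨hqM, n, hn, heq⟩ := exists_reflect_drop_eq hq ha h1 h2
  have hcl : a ∉ closure (univoqueSeqs M q) := by
    intro hcl
    obtain ⟨d, hd, hag⟩ := mem_closure_iff_agree.1 hcl (n + 1 + (n + 1))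
    obtain ⟨h3, h4⟩ := strictLexBound_of_mem_univoqueSeqs hq ha hd
    exact not_agree_of_strictLexBound hn heq h3 h4 hag
  refine ⟨a, (mem_vSeqs_iff hq).2 ⟨ha.isInfinite, h1⟩, hcl, fun hv => hcl ?_⟩
  -- By compactness, if the value `1` of `a` were a limit of `𝒰_q`, it would be the value of some
  -- `c` in the closure of `𝒰_q'`; the weak bounds pass to `c` and identify it with `a`.
  have hclosed : IsClosed (val q '' closure (univoqueSeqs M q)) :=
    (isClosed_closure.isCompact.image (continuous_val hq)).isClosed
  obtain ⟨c, hc, hca⟩ := closure_minimal (image_mono subset_closure) hclosed hv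
  have hc2 := closure_minimal (univoqueSeqs_subset_twoSided hq) (isClosed_twoSided hq) hc
  rw [← IsQuasiGreedyOne.unique hq
    ⟨hca.trans ha.val_eq, mem_twoSided_isInfinite hq hqM hc2, hc2.1⟩ ha]
  exact hc

/-- The `𝒰` maps fail from the right, where `a` suddenly belongs to `𝒰_p'`; the `𝒱` maps fail from
the left, where `𝒱_p' ⊆ 𝒰_q'` stays away from `a`. -/
theorem IsJump.not_hausdorffContinuousAt {q : ℝ} (hq : 1 < q) (h : IsJump M q) :
    ¬ HausdorffContinuousAt (univoqueSeqs M) q ∧ ¬ HausdorffContinuousAt (univoqueNumbers M) q ∧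
      ¬ HausdorffContinuousAt (vSeqs M) q ∧ ¬ HausdorffContinuousAt (vNumbers M) q := by
  obtain ⟨a, ha, h1, h2⟩ := h.exists_isolated hq
  have ha2 := ((mem_vSeqs_iff hq).1 ha).2
  simp only [Metric.mem_closure_iff, not_forall, not_exists, not_and, not_lt] at h1 h2
  obtain ⟨ε, hε, h1⟩ := h1
  obtain ⟨η, hη, h2⟩ := h2
  have hvU : ∀ p, 1 < p → p < q → vSeqs M p ⊆ univoqueSeqs M q := fun p hp hpq c hc =>
    twoSided_subset_univoqueSeqs hp hpq ((mem_vSeqs_iff hp).1 hc).2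
  -- Half of `η` absorbs the change of base in the values, the other half the Hausdorff distance.
  have hval : ∀ᶠ p in 𝓝 q, ∀ c : DigitSeq M, |val p c - val q c| < η / 2 :=
    eventually_abs_val_sub_lt hq (half_pos hη)
  refine ⟨fun hc => ?_, fun hc => ?_, fun hc => ?_, fun hc => ?_⟩
  · obtain ⟨p, hp, hpq⟩ := (((exists_dist_lt_of_tendsto hc hε).filter_mono
      (nhdsGT_le_nhdsWithin_Ioi hq.le)).and self_mem_nhdsWithin).exists
    obtain ⟨d, hd, hlt⟩ := hp.1 a (twoSided_subset_univoqueSeqs hq hpq ha2)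
    exact absurd hlt (not_lt.2 (h1 d hd))
  · obtain ⟨p, ⟨hp, hv⟩, hpq⟩ := ((((exists_dist_lt_of_tendsto hc (half_pos hη)).filter_mono
      (nhdsGT_le_nhdsWithin_Ioi hq.le)).and (hval.filter_mono nhdsWithin_le_nhds)).and
        self_mem_nhdsWithin).exists
    rw [univoqueNumbers_eq_image hq, univoqueNumbers_eq_image (hq.trans hpq)] at hp
    obtain ⟨y, hy, hlt⟩ := hp.1 _ ⟨a, twoSided_subset_univoqueSeqs hq hpq ha2, rfl⟩
    have h3 := h2 y hy
    have h4 := dist_triangle_left (val q a) y (val p a)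
    have h5 := hv a
    rw [← Real.dist_eq] at h5
    linarith
  · obtain ⟨p, ⟨hp, hp1⟩, hpq⟩ := ((((exists_dist_lt_of_tendsto hc hε).filter_mono
      (nhdsLT_le_nhdsWithin_Ioi hq)).and ((lt_mem_nhds hq).filter_mono nhdsWithin_le_nhds)).and
        self_mem_nhdsWithin).exists
    obtain ⟨d, hd, hlt⟩ := hp.2 a ha
    exact absurd hlt (not_lt.2 (h1 d (hvU p hp1 hpq hd)))
  · obtain ⟨p, ⟨⟨hp, hv⟩, hp1⟩, hpq⟩ := (((((exists_dist_lt_of_tendsto hc (half_pos hη)).filter_mono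
      (nhdsLT_le_nhdsWithin_Ioi hq)).and (hval.filter_mono nhdsWithin_le_nhds)).and
        ((lt_mem_nhds hq).filter_mono nhdsWithin_le_nhds)).and self_mem_nhdsWithin).exists
    rw [vNumbers_eq_image hq, vNumbers_eq_image hp1] at hp
    obtain ⟨_, ⟨c, hc', rfl⟩, hlt⟩ := hp.2 _ ⟨a, ha, rfl⟩
    have h3 := h2 _ ⟨c, hvU p hp1 hpq hc', rfl⟩
    have h4 := dist_triangle (val q a) (val p c) (val q c)
    have h5 := hv c
    rw [← Real.dist_eq] at h5
    linarith

end DigitSeq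

open DigitSeq in
theorem theorem1 (M : ℕ) (hM : 1 ≤ M) :
    (∀ q : ℝ, 1 < q →
      HausdorffLeftContinuousAt (univoqueSeqs M) q ∧
      HausdorffLeftContinuousAt (univoqueNumbers M) q) ∧
    (∀ q : ℝ, 1 < q →
      HausdorffRightContinuousAt (vSeqs M) q ∧
      HausdorffRightContinuousAt (vNumbers M) q) ∧
    (∀ q : ℝ, 1 < q →
      (HausdorffContinuousAt (univoqueSeqs M) q ↔ q ∉ vBases M \ closure (univoqueBases M)) ∧
      (HausdorffContinuousAt (univoqueNumbers M) q ↔ q ∉ vBases M \ closure (univoqueBases M)) ∧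
      (HausdorffContinuousAt (vSeqs M) q ↔ q ∉ vBases M \ closure (univoqueBases M)) ∧
      (HausdorffContinuousAt (vNumbers M) q ↔ q ∉ vBases M \ closure (univoqueBases M))) := by
  refine ⟨fun q hq => ?_, fun q hq => ?_, fun q hq => ?_⟩
  · exact (prefixClose_univoqueSeqs_left hq).hausdorffContinuousWithinAt hq
      fun p hp => univoqueNumbers_eq_image hp
  · exact (prefixClose_vSeqs_right hq hM).hausdorffContinuousWithinAt hq
      fun p hp => vNumbers_eq_image hp
  · rw [← isJump_iff hq]
    by_cases hj : IsJump M q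
    · obtain ⟨h1, h2, h3, h4⟩ := hj.not_hausdorffContinuousAt hq
      simp [hj, h1, h2, h3, h4]
    · obtain ⟨h1, h2⟩ := (prefixClose_univoqueSeqs hq hj).hausdorffContinuousWithinAt hq
        fun p hp => univoqueNumbers_eq_image hp
      obtain ⟨h3, h4⟩ := (prefixClose_vSeqs hq hM hj).hausdorffContinuousWithinAt hq
        fun p hp => vNumbers_eq_image hp
      exact ⟨⟨fun _ => hj, fun _ => h1⟩, ⟨fun _ => hj, fun _ => h2⟩, ⟨fun _ => hj, fun _ => h3⟩,
        ⟨fun _ => hj, fun _ => h4⟩⟩
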